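/- Let $G$ be a connected simple undirected graph on $n \ge 3$ vertices $\{1,\dots,n\}$, let $\Omega$ be one of $\mathbb{R}$, $\mathbb{C}$ or $(0,\infty)$, and let $f:\Omega\to\mathbb{C}$. Let $M_G(\Omega)$ be the set of complex $n\times n$ matrices $A=(a_{ij})$ with $a_{ij}=0$ whenever $i\ne j$ and $i,j$ are not adjacent in $G$, and $a_{ij}\in\Omega$ for all other $i,j$. For $A\in M_G(\Omega)$ let $f_G[A]$ be the $n\times n$ matrix whose $(i,j)$ entry is $f(a_{ij})$ if $i=j$ or $i,j$ are adjacent in $G$, and $0$ otherwise. (Positive definite and positive semidefinite matrices are understood to be Hermitian.) 1. If $G$ is a tree, then the following are equivalent: (a) for every Hermitian $A\in M_G(\Omega)$, $A$ is positive definite if and only if $f_G[A]$ is positive definite; (b) there is a real $\alpha>0$ such that $f(x)=\alpha\,\mathrm{sgn}(x)|x|$ $(=\alpha x)$ for all $x\in\Omega\cap\mathbb{R}$, and $|f(z)|=\alpha|z|$ and $f(\overline{z})=\overline{f(z)}$ for all $z\in\Omega\setminus\mathbb{R}$. 2. If $G$ is not a tree, then the following are equivalent: (a) for every Hermitian $A\in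 M_G(\Omega)$, $A$ is positive definite if and only if $f_G[A]$ is positive definite; (b) there is a real $\alpha>0$ such that either $f(z)=\alpha z$ for all $z\in\Omega$, or $f(z)=\alpha\overline{z}$ for all $z\in\Omega$. The same equivalences hold with "positive definite" replaced by "positive semidefinite" throughout. -/

import Mathlib

open scoped ComplexOrder

namespace SignPreservers

/-- The set `M_G(Ω)`: complex matrices indexed by the vertices of `G` whose `(i, j)` entry is `0`
whenever `i ≠ j` are not adjacent, and lies in `Ω` otherwise (on the diagonal and on edges). -/
def graphMatrices {V : Type*} (G : SimpleGraph V) (Ω : Set ℂ) : Set (Matrix V V ℂ) :=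
  {A | ∀ i j, (i ≠ j ∧ ¬ G.Adj i j → A i j = 0) ∧ (i = j ∨ G.Adj i j → A i j ∈ Ω)}

open Classical in
/-- The matrix `f_G[A]`: apply `f` to the entries on the diagonal and on the edges of `G`,
and put `0` elsewhere. For `A ∈ M_G(Ω)` only the values of `f` on `Ω` are used, so a function
on `Ω` is represented by any extension of it to `ℂ`. -/
noncomputable def graphMap {V : Type*} (G : SimpleGraph V) (f : ℂ → ℂ) (A : Matrix V V ℂ) :
    Matrix V V ℂ :=
  Matrix.of fun i j => if i = j ∨ G.Adj i j then f (A i j) else 0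

/-- `f_G` is a positive definite sign preserver on `M_G(Ω)`. -/
def IsPosDefSignPreserver {V : Type*} (G : SimpleGraph V) (Ω : Set ℂ) (f : ℂ → ℂ) : Prop :=
  ∀ A ∈ graphMatrices G Ω, A.IsHermitian → (A.PosDef ↔ (graphMap G f A).PosDef)

/-- `f_G` is a positive semidefinite sign preserver on `M_G(Ω)`. -/
def IsPosSemidefSignPreserver {V : Type*} (G : SimpleGraph V) (Ω : Set ℂ) (f : ℂ → ℂ) : Prop :=
  ∀ A ∈ graphMatrices G Ω, A.IsHermitian → (A.PosSemidef ↔ (graphMap G f A).PosSemidef)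

/-- `f(x) = α sgn(x) |x|^β` at the real points `x` of `Ω`, while `|f(z)| = α |z|^β` and
`f(conj z) = conj (f z)` at the non-real points `z` of `Ω`. -/
def IsPowerTypeOn (Ω : Set ℂ) (f : ℂ → ℂ) (α β : ℝ) : Prop :=
  (∀ x : ℝ, (x : ℂ) ∈ Ω → f x = ((α * Real.sign x * |x| ^ β : ℝ) : ℂ)) ∧
    ∀ z ∈ Ω, z.im ≠ 0 →
      ‖f z‖ = α * ‖z‖ ^ β ∧ f (starRingEnd ℂ z) = starRingEnd ℂ (f z)

/-- On `Ω`, `f` is `z ↦ α z` or `z ↦ α conj z` for one constant `α > 0`. -/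
def IsPositiveMultipleOn (Ω : Set ℂ) (f : ℂ → ℂ) : Prop :=
  ∃ α : ℝ, 0 < α ∧
    ((∀ z ∈ Ω, f z = (α : ℂ) * z) ∨ (∀ z ∈ Ω, f z = (α : ℂ) * starRingEnd ℂ z))

/-- The real line as a subset of `ℂ`. -/
def realLine : Set ℂ := Set.range ((↑) : ℝ → ℂ)

/-- The open half-line `(0, ∞)` as a subset of `ℂ`. -/
def positiveHalfLine : Set ℂ := ((↑) : ℝ → ℂ) '' Set.Ioi 0

end SignPreservers

namespace SignPreservers

open Matrix

/-! Both kinds of sign preserver satisfy one weaker condition, `IsWeakSignPreserver`: positive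
definite goes to semidefinite, and only semidefinite matrices have definite images. This condition
is tested on small matrices. A small definite matrix extends to the pattern of `G` with a fixed
number on the other edges and large diagonal entries elsewhere, so the condition passes to induced
subgraphs (`IsWeakSignPreserver.comap`).

On an edge, the 2 × 2 determinants compare `b ^ 2` with `a * c` and `f(b) ^ 2` with `f(a) * f(c)`.
In logarithmic coordinates `f` is then affine on `(0, ∞)`, so `f(x) = α x ^ β`. Two edges at a
common vertex give a 3 × 3 matrix whose definiteness threshold must be carried to itself; this is
equality in the midpoint convexity inequality for `x ^ β`, whence `β = 1`
(`IsWeakSignPreserver.eq_mul_of_pos`). Further 2 × 2 tests give `|f(z)| = α|z|` and compatibility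
with conjugation (`IsModulusLinearOn`).

So `f` multiplies each entry by `α` and a phase. On a tree the edge phases form a coboundary `θ i *
(θ j)⁻¹`, and `f_G[A] = α D A D*` with `D` diagonal unitary: every such `f` works
(`posDef_graphMap_iff_of_isTree`).

If there is a cycle and `Ω = ℂ`, take a vertex `v` on it with neighbours `i`, `j` joined off `v`.
Bordering a real matrix `M` on the other vertices by a row with entries `z`, `w` at `i`, `j`, the
Schur complement sees `z * conj w` through the entry `(i, j)` of `M⁻¹`, which is positive when `M`
is diagonally dominant with negative edge entries. Hence `f / α` preserves the real inner product of
`ℂ` and fixes 1: it is the identity or conjugation. -/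

/-! ### Positivity from large diagonal entries -/

theorem posDef_of_re_pos {V : Type*} [Fintype V] {A : Matrix V V ℂ} (hA : A.IsHermitian)
    (h : ∀ x : V → ℂ, x ≠ 0 → 0 < (star x ⬝ᵥ (A *ᵥ x)).re) : A.PosDef := by
  refine PosDef.of_dotProduct_mulVec_pos hA fun x hx => ?_
  rw [Complex.pos_iff]
  exact ⟨h x hx, (hA.im_star_dotProduct_mulVec_self x).symm⟩

/-- A form positive on the compact zero set of a nonnegative function becomes positive after
adding a large multiple of that function. -/
theorem exists_forall_add_mul_pos {X : Type*} [TopologicalSpace X] [T2Space X] {K : Set X} (hK : IsCompact K)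
    {Q p : X → ℝ} (hQ : ContinuousOn Q K) (hp : ContinuousOn p K) (hp0 : ∀ x ∈ K, 0 ≤ p x)
    (h : ∀ x ∈ K, p x = 0 → 0 < Q x) :
    ∃ T₀ : ℝ, ∀ T ≥ T₀, ∀ x ∈ K, 0 < Q x + T * p x := by
  have hZ : IsCompact {x ∈ K | Q x ≤ 0} := by
    have := hQ.preimage_isClosed_of_isClosed hK.isClosed (isClosed_Iic (a := (0 : ℝ)))
    exact hK.of_isClosed_subset this Set.inter_subset_left
  rcases Set.eq_empty_or_nonempty {x ∈ K | Q x ≤ 0} with hZe | hZn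
  · refine ⟨0, fun T hT x hx => ?_⟩
    have : 0 < Q x := by
      by_contra! hle
      exact (hZe ▸ (⟨hx, hle⟩ : x ∈ {x ∈ K | Q x ≤ 0}) : x ∈ (∅ : Set X))
    have := mul_nonneg hT (hp0 x hx)
    linarith
  · obtain ⟨a, ha, hamin⟩ := hZ.exists_isMinOn hZn (hp.mono fun x hx => hx.1)
    obtain ⟨b, hb, hbmin⟩ := hZ.exists_isMinOn hZn (hQ.mono fun x hx => hx.1)
    have hpa : 0 < p a := (hp0 a ha.1).lt_of_ne fun h0 => absurd (h a ha.1 h0.symm) ha.2.not_gt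
    refine ⟨(1 - Q b) / p a, fun T hT x hx => ?_⟩
    have hT' : 1 - Q b ≤ T * p a := (div_le_iff₀ hpa).1 hT
    have hb0 : Q b ≤ 0 := hb.2
    have hT0 : 0 ≤ T := le_trans (div_nonneg (by linarith) hpa.le) hT
    rcases lt_or_ge 0 (Q x) with hQx | hQx
    · have := mul_nonneg hT0 (hp0 x hx)
      linarith
    · have h1 : p a ≤ p x := hamin ⟨hx, hQx⟩
      have h2 : Q b ≤ Q x := hbmin ⟨hx, hQx⟩
      have := mul_le_mul_of_nonneg_left h1 hT0
      linarith

/-- Compactness of the unit sphere gives one `T₀` for all unit vectors; homogeneity of the form does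
the rest. -/
theorem exists_posDef_add_diagonal {V : Type*} [Fintype V] [DecidableEq V] {N : Matrix V V ℂ}
    (hN : N.IsHermitian) (p : V → Prop) [DecidablePred p]
    (h : ∀ x : V → ℂ, x ≠ 0 → (∀ v, p v → x v = 0) → 0 < (star x ⬝ᵥ (N *ᵥ x)).re) :
    ∃ T₀ : ℝ, ∀ T : ℝ, T₀ ≤ T →
      (N + diagonal fun v => if p v then (T : ℂ) else 0).PosDef := by
  obtain ⟨T₀, hT₀⟩ := exists_forall_add_mul_pos (isCompact_sphere (0 : V → ℂ) 1)
    (Q := fun x => (star x ⬝ᵥ (N *ᵥ x)).re)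
    (p := fun x => ∑ v, if p v then ‖x v‖ ^ 2 else 0)
    (by
      refine Continuous.continuousOn ?_
      simp only [dotProduct, mulVec, Pi.star_apply]
      fun_prop)
    (by
      refine Continuous.continuousOn (continuous_finsetSum _ fun v _ => ?_)
      split_ifs <;> fun_prop)
    (fun x _ => Finset.sum_nonneg fun v _ => by split_ifs <;> positivity)
    (fun x hx h0 => by
      refine h x (fun hx0 => by simp [hx0] at hx) fun v hv => ?_
      rw [Finset.sum_eq_zero_iff_of_nonneg (fun v _ => by split_ifs <;> positivity)] at h0
      simpa [hv] using h0 v (Finset.mem_univ v))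
  refine ⟨T₀, fun T hT => posDef_of_re_pos (hN.add ?_) fun x hx => ?_⟩
  · refine isHermitian_diagonal_of_self_adjoint _ (funext fun v => ?_)
    simp only [Pi.star_apply]
    split_ifs <;> simp
  · have hxn : 0 < ‖x‖ := norm_pos_iff.2 hx
    have hy := hT₀ T hT (((‖x‖⁻¹ : ℝ) : ℂ) • x) (by
      simp [norm_smul, hxn.ne'])
    have key : ∀ y : V → ℂ, (star y ⬝ᵥ ((N + diagonal fun v => if p v then (T : ℂ) else 0) *ᵥ y)).re
        = (star y ⬝ᵥ (N *ᵥ y)).re + T * ∑ v, if p v then ‖y v‖ ^ 2 else 0 := by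
      intro y
      rw [add_mulVec, dotProduct_add, Complex.add_re, Finset.mul_sum]
      congr 1
      simp only [dotProduct, mulVec_diagonal, Pi.star_apply, Complex.re_sum]
      refine Finset.sum_congr rfl fun v _ => ?_
      split_ifs
      · rw [← Complex.normSq_eq_norm_sq, Complex.normSq_apply]
        simp
        ring
      · simp
    rw [← key, mulVec_smul, dotProduct_smul] at hy
    simp only [star_smul, smul_dotProduct, smul_eq_mul, RCLike.star_def, Complex.conj_ofReal,
      Complex.re_ofReal_mul] at hy
    exact pos_of_mul_pos_right (pos_of_mul_pos_right hy (by positivity)) (by positivity)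

/-! ### Padding a small matrix to the pattern of a graph -/

theorem graphMap_apply_of {V : Type*} {G : SimpleGraph V} {f : ℂ → ℂ} {A : Matrix V V ℂ} {i j : V}
    (h : i = j ∨ G.Adj i j) : graphMap G f A i j = f (A i j) := by
  simp only [graphMap, of_apply, if_pos h]

theorem graphMap_apply_of_not {V : Type*} {G : SimpleGraph V} {f : ℂ → ℂ} {A : Matrix V V ℂ}
    {i j : V} (h : ¬ (i = j ∨ G.Adj i j)) : graphMap G f A i j = 0 := by
  simp only [graphMap, of_apply, if_neg h]

theorem mem_graphMatrices_iff {V : Type*} {G : SimpleGraph V} {Ω : Set ℂ} {A : Matrix V V ℂ} :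
    A ∈ graphMatrices G Ω ↔
      ∀ i j, (¬ (i = j ∨ G.Adj i j) → A i j = 0) ∧ (i = j ∨ G.Adj i j → A i j ∈ Ω) := by
  simp only [graphMatrices, Set.mem_ofPred_eq, not_or, ne_eq]

open Classical in
/-- Extend a matrix indexed by `ι` along `e : ι → V` to a matrix with the zero pattern of `G`,
with entries `c` on the remaining edges and `d` at the remaining diagonal places. -/
noncomputable def pad {V ι : Type*} (G : SimpleGraph V) (e : ι → V) (C : Matrix ι ι ℂ) (c d : ℂ) :
    Matrix V V ℂ :=
  of fun i j => if i = j ∨ G.Adj i j then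
    (if h : (∃ p, e p = i) ∧ ∃ q, e q = j then C h.1.choose h.2.choose
      else if i = j then d else c) else 0

section pad

variable {V ι : Type*} {G : SimpleGraph V} {e : ι → V} {C : Matrix ι ι ℂ} {c d : ℂ} {i j : V}

theorem pad_apply_of_not (h : ¬ (i = j ∨ G.Adj i j)) : pad G e C c d i j = 0 := by
  simp only [pad, of_apply, if_neg h]

theorem pad_apply_range (he : Function.Injective e) (p q : ι) (h : e p = e q ∨ G.Adj (e p) (e q)) :
    pad G e C c d (e p) (e q) = C p q := by
  have h' : (∃ p', e p' = e p) ∧ ∃ q', e q' = e q := ⟨⟨p, rfl⟩, ⟨q, rfl⟩⟩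
  simp only [pad, of_apply, if_pos h, dif_pos h']
  rw [he h'.1.choose_spec, he h'.2.choose_spec]

theorem pad_apply_self_of_notMem (h : i ∉ Set.range e) : pad G e C c d i i = d := by
  have h' : ¬ ((∃ p, e p = i) ∧ ∃ q, e q = i) := fun h' => h h'.1
  simp only [pad, of_apply, true_or, if_true, dif_neg h']

theorem pad_apply_adj (hij : G.Adj i j) (h : ¬ (i ∈ Set.range e ∧ j ∈ Set.range e)) :
    pad G e C c d i j = c := by
  have h' : ¬ ((∃ p, e p = i) ∧ ∃ q, e q = j) := h
  simp only [pad, of_apply, hij, or_true, if_true, dif_neg h', if_neg hij.ne]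

/-- The four kinds of entries of a padded matrix. -/
theorem pad_cases {P : V → V → Prop} (h0 : ∀ i j, ¬ (i = j ∨ G.Adj i j) → P i j)
    (h1 : ∀ p q, e p = e q ∨ G.Adj (e p) (e q) → P (e p) (e q))
    (h2 : ∀ i, i ∉ Set.range e → P i i)
    (h3 : ∀ i j, G.Adj i j → ¬ (i ∈ Set.range e ∧ j ∈ Set.range e) → P i j) (i j : V) : P i j := by
  by_cases h : i = j ∨ G.Adj i j
  · by_cases hr : i ∈ Set.range e ∧ j ∈ Set.range e
    · obtain ⟨⟨p, rfl⟩, ⟨q, rfl⟩⟩ := hr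
      exact h1 p q h
    · rcases h with rfl | h
      · exact h2 i fun hi => hr ⟨hi, hi⟩
      · exact h3 i j h hr
  · exact h0 i j h

theorem pad_isHermitian (he : Function.Injective e) (hC : C.IsHermitian) (hc : star c = c)
    (hd : star d = d) : (pad G e C c d).IsHermitian := by
  refine IsHermitian.ext <| pad_cases (G := G) (e := e) (fun i j h => ?_) (fun p q h => ?_) (fun i h => ?_)
    (fun i j h h' => ?_)
  · rw [pad_apply_of_not h, pad_apply_of_not (fun h' => h (h'.imp Eq.symm fun a => a.symm)),
      star_zero]
  · rw [pad_apply_range he p q h, pad_apply_range he q p (h.imp Eq.symm fun a => a.symm),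
      hC.apply]
  · rw [pad_apply_self_of_notMem h, hd]
  · rw [pad_apply_adj h h', pad_apply_adj h.symm (fun h => h' h.symm), hc]

theorem pad_mem_graphMatrices (he : Function.Injective e) {Ω : Set ℂ}
    (hC : C ∈ graphMatrices (G.comap e) Ω) (hc : c ∈ Ω) (hd : d ∈ Ω) :
    pad G e C c d ∈ graphMatrices G Ω := by
  rw [mem_graphMatrices_iff] at hC ⊢
  refine pad_cases (G := G) (e := e) (fun i j h => ?_) (fun p q h => ?_) (fun i h => ?_)
    (fun i j h h' => ?_)
  · exact ⟨fun _ => pad_apply_of_not h, fun h' => absurd h' h⟩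
  · refine ⟨fun h' => absurd h h', fun _ => ?_⟩
    rw [pad_apply_range he p q h]
    exact (hC p q).2 (h.imp (fun h => he h) id)
  · exact ⟨fun h' => absurd (Or.inl rfl) h', fun _ => by rwa [pad_apply_self_of_notMem h]⟩
  · exact ⟨fun h' => absurd (Or.inr h) h', fun _ => by rwa [pad_apply_adj h h']⟩

theorem graphMap_pad (he : Function.Injective e) (f : ℂ → ℂ) :
    graphMap G f (pad G e C c d) = pad G e (graphMap (G.comap e) f C) (f c) (f d) := by
  refine Matrix.ext <| pad_cases (G := G) (e := e) (fun i j h => ?_) (fun p q h => ?_) (fun i h => ?_)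
    (fun i j h h' => ?_)
  · rw [graphMap_apply_of_not h, pad_apply_of_not h]
  · rw [graphMap_apply_of h, pad_apply_range he p q h, pad_apply_range he p q h,
      graphMap_apply_of (h.imp (fun h => he h) id)]
  · rw [graphMap_apply_of (Or.inl rfl), pad_apply_self_of_notMem h, pad_apply_self_of_notMem h]
  · rw [graphMap_apply_of (Or.inr h), pad_apply_adj h h', pad_apply_adj h h']

theorem pad_submatrix (he : Function.Injective e)
    (hC : ∀ p q, ¬ (p = q ∨ (G.comap e).Adj p q) → C p q = 0) :
    (pad G e C c d).submatrix e e = C := by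
  ext p q
  rw [submatrix_apply]
  by_cases h : e p = e q ∨ G.Adj (e p) (e q)
  · exact pad_apply_range he p q h
  · rw [pad_apply_of_not h, hC p q fun h' => h (h'.imp (congrArg e) id)]

/-- On vectors supported in the range of `e` the padded form is that of `C`; a large diagonal
outside the range controls all other directions, whatever the edge value `c`. -/
theorem exists_pad_posDef [Fintype V] [Fintype ι] (he : Function.Injective e) (hCp : C.PosDef)
    (hC : ∀ p q, ¬ (p = q ∨ (G.comap e).Adj p q) → C p q = 0) (hc : star c = c) :
    ∃ T₀ : ℝ, ∀ T : ℝ, T₀ ≤ T → (pad G e C c T).PosDef := by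
  classical
  obtain ⟨T₀, hT₀⟩ := exists_posDef_add_diagonal
    (pad_isHermitian (G := G) he hCp.isHermitian hc (star_zero ℂ)) (fun v => v ∉ Set.range e)
    (fun x hx hxe => by
      have hsum : star x ⬝ᵥ (pad G e C c 0 *ᵥ x) = star (x ∘ e) ⬝ᵥ (C *ᵥ (x ∘ e)) := by
        simp only [dotProduct, mulVec]
        symm
        refine Fintype.sum_of_injective e he _ _ (fun i hi => by simp [hxe i hi]) fun p => ?_
        simp only [Pi.star_apply, Function.comp_apply]
        congr 1
        refine Fintype.sum_of_injective e he _ _ (fun i hi => by simp [hxe i hi]) fun q => ?_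
        exact congrArg (· * x (e q)) (congrFun₂ (pad_submatrix (c := c) (d := 0) he hC) p q).symm
      rw [hsum]
      refine hCp.re_dotProduct_pos (fun h0 => hx (funext fun v => ?_))
      by_cases hv : v ∈ Set.range e
      · obtain ⟨p, rfl⟩ := hv
        exact congrFun h0 p
      · exact hxe v hv)
  refine ⟨T₀, fun T hT => ?_⟩
  convert hT₀ T hT using 1
  refine Matrix.ext <| pad_cases (G := G) (e := e) (fun i j h => ?_) (fun p q h => ?_) (fun i h => ?_)
    (fun i j h h' => ?_)
  · rw [Matrix.add_apply, pad_apply_of_not h, pad_apply_of_not h, diagonal_apply_ne _ fun h' => h (Or.inl h'),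
      add_zero]
  · rw [Matrix.add_apply, pad_apply_range he p q h, pad_apply_range he p q h]
    by_cases hpq : e p = e q
    · simp [hpq]
    · simp [hpq]
  · rw [Matrix.add_apply, pad_apply_self_of_notMem h, pad_apply_self_of_notMem h, diagonal_apply_eq, if_pos h,
      zero_add]
  · rw [Matrix.add_apply, pad_apply_adj h h', pad_apply_adj h h', diagonal_apply_ne _ h.ne, add_zero]

end pad

/-! ### Weak sign preservers and passage to induced subgraphs -/

/-- On `M_G(Ω)`, `f_G` sends positive definite matrices to positive semidefinite ones, and only
positive semidefinite matrices to positive definite ones. -/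
def IsWeakSignPreserver {V : Type*} (G : SimpleGraph V) (Ω : Set ℂ) (f : ℂ → ℂ) : Prop :=
  ∀ A ∈ graphMatrices G Ω, A.IsHermitian →
    (A.PosDef → (graphMap G f A).PosSemidef) ∧ ((graphMap G f A).PosDef → A.PosSemidef)

theorem IsPosDefSignPreserver.weak {V : Type*} {G : SimpleGraph V} {Ω : Set ℂ} {f : ℂ → ℂ}
    (h : IsPosDefSignPreserver G Ω f) : IsWeakSignPreserver G Ω f := fun A hA hH =>
  ⟨fun hp => ((h A hA hH).1 hp).posSemidef, fun hp => ((h A hA hH).2 hp).posSemidef⟩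

theorem IsPosSemidefSignPreserver.weak {V : Type*} {G : SimpleGraph V} {Ω : Set ℂ} {f : ℂ → ℂ}
    (h : IsPosSemidefSignPreserver G Ω f) : IsWeakSignPreserver G Ω f := fun A hA hH =>
  ⟨fun hp => (h A hA hH).1 hp.posSemidef, fun hp => (h A hA hH).2 hp.posSemidef⟩

section hereditary

variable {V ι : Type*} [Fintype V] [Fintype ι] {G : SimpleGraph V} {Ω : Set ℂ} {f : ℂ → ℂ}
  {e : ι → V} {C : Matrix ι ι ℂ}

theorem IsWeakSignPreserver.posSemidef_graphMap_comap (hf : IsWeakSignPreserver G Ω f)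
    (hΩ : ∀ x : ℝ, 0 < x → (x : ℂ) ∈ Ω) (he : Function.Injective e)
    (hC : C ∈ graphMatrices (G.comap e) Ω) (hp : C.PosDef) :
    (graphMap (G.comap e) f C).PosSemidef := by
  obtain ⟨T₀, hT₀⟩ := exists_pad_posDef (G := G) (c := 1) he hp
    (fun p q h => (mem_graphMatrices_iff.1 hC p q).1 h) (star_one ℂ)
  have hT := hT₀ (max T₀ 1) (le_max_left _ _)
  have hmem := pad_mem_graphMatrices he hC (by simpa using hΩ 1 one_pos)
    (hΩ (max T₀ 1) (by positivity))
  have := ((hf _ hmem hT.isHermitian).1 hT).submatrix e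
  rwa [graphMap_pad he, pad_submatrix he fun p q h => graphMap_apply_of_not h] at this

/-- Here the image must be padded to a definite matrix, so large diagonal entries have to be values
of `f` and the edge value `f 1` must be real. These are the roles of `hunb` and `h1`. -/
theorem IsWeakSignPreserver.posSemidef_of_graphMap_comap (hf : IsWeakSignPreserver G Ω f)
    (hΩ : ∀ x : ℝ, 0 < x → (x : ℂ) ∈ Ω) (h1 : star (f 1) = f 1)
    (hunb : ∀ K : ℝ, ∃ x y : ℝ, 0 < x ∧ K ≤ y ∧ f x = y) (he : Function.Injective e)
    (hC : C ∈ graphMatrices (G.comap e) Ω) (hH : C.IsHermitian)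
    (hp : (graphMap (G.comap e) f C).PosDef) : C.PosSemidef := by
  obtain ⟨T₀, hT₀⟩ := exists_pad_posDef (G := G) (c := f 1) he hp
    (fun p q h => graphMap_apply_of_not h) h1
  obtain ⟨x, y, hx, hy, hxy⟩ := hunb T₀
  have hmem := pad_mem_graphMatrices he hC (by simpa using hΩ 1 one_pos) (hΩ x hx)
  have := (hf _ hmem (pad_isHermitian he hH (star_one ℂ) (Complex.conj_ofReal x))).2 (by
    rw [graphMap_pad he, hxy]
    exact hT₀ y hy)
  have := this.submatrix e
  rwa [pad_submatrix he fun p q h => (mem_graphMatrices_iff.1 hC p q).1 h] at this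

theorem IsWeakSignPreserver.comap (hf : IsWeakSignPreserver G Ω f)
    (hΩ : ∀ x : ℝ, 0 < x → (x : ℂ) ∈ Ω) (h1 : star (f 1) = f 1)
    (hunb : ∀ K : ℝ, ∃ x y : ℝ, 0 < x ∧ K ≤ y ∧ f x = y) (he : Function.Injective e) :
    IsWeakSignPreserver (G.comap e) Ω f := fun _ hA hH =>
  ⟨hf.posSemidef_graphMap_comap hΩ he hA, hf.posSemidef_of_graphMap_comap hΩ h1 hunb he hA hH⟩

end hereditary

/-! ### Functional inequalities forcing powers, and the exponent 1 -/

/-- A real function that is midpoint convex and midpoint concave up to strict inequality between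
the arguments is affine. -/
theorem eq_affine_of_strict_midpoint {g : ℝ → ℝ} (h1 : ∀ r s t, 2 * r < s + t → 2 * g r ≤ g s + g t)
    (h2 : ∀ r s t, s + t < 2 * r → g s + g t ≤ 2 * g r) (t : ℝ) :
    g t = g 0 + t * (g 1 - g 0) := by
  have hmono : Monotone g := by
    intro r s hrs
    rcases hrs.eq_or_lt with rfl | hrs
    · exact le_rfl
    · have := h1 r s s (by linarith)
      linarith
  have hcont : Continuous g := by
    refine continuous_iff_continuousAt.2 fun m => ?_
    rw [hmono.continuousAt_iff_leftLim_eq_rightLim]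
    refine le_antisymm ((hmono.leftLim_le le_rfl).trans (hmono.le_rightLim le_rfl)) ?_
    have hl : Filter.Tendsto (fun δ : ℝ => g (m - δ)) (nhdsWithin 0 (Set.Ioi 0))
        (nhds (Function.leftLim g m)) := by
      refine (hmono.tendsto_leftLim m).comp (tendsto_nhdsWithin_iff.2 ⟨?_, ?_⟩)
      · have : Continuous fun δ : ℝ => m - δ := by fun_prop
        simpa using (this.tendsto 0).mono_left nhdsWithin_le_nhds
      · filter_upwards [self_mem_nhdsWithin] with δ hδ
        simpa using hδ
    have hr : ∀ k : ℝ, 0 < k → Filter.Tendsto (fun δ : ℝ => g (m + k * δ))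
        (nhdsWithin 0 (Set.Ioi 0)) (nhds (Function.rightLim g m)) := by
      intro k hk
      refine (hmono.tendsto_rightLim m).comp (tendsto_nhdsWithin_iff.2 ⟨?_, ?_⟩)
      · have : Continuous fun δ : ℝ => m + k * δ := by fun_prop
        simpa using (this.tendsto 0).mono_left nhdsWithin_le_nhds
      · filter_upwards [self_mem_nhdsWithin] with δ hδ
        simpa using mul_pos hk hδ
    -- The points `m + δ`, `m - δ`, `m + 4δ` satisfy the strict hypothesis of `h1`. With `L`, `R`
    -- the one-sided limits, letting `δ → 0` gives `2R ≤ L + R`, so there is no jump.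
    have := le_of_tendsto_of_tendsto ((hr 1 one_pos).const_mul 2) (hl.add (hr 4 (by norm_num)))
      (by
        filter_upwards [self_mem_nhdsWithin] with δ hδ
        have hδ' : (0 : ℝ) < δ := hδ
        exact h1 _ _ _ (by linarith))
    linarith
  have hmid : ∀ s t, g s + g t = 2 * g ((s + t) / 2) := by
    intro s t
    refine le_antisymm ?_ ?_
    · have hc : Continuous fun r => 2 * g r := by fun_prop
      refine ge_of_tendsto ((hc.tendsto ((s + t) / 2)).mono_left
        (nhdsWithin_le_nhds (s := Set.Ioi ((s + t) / 2)))) ?_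
      filter_upwards [self_mem_nhdsWithin] with r hr
      have hr' : (s + t) / 2 < r := hr
      exact h2 _ _ _ (by linarith)
    · have hc : Continuous fun r => 2 * g r := by fun_prop
      refine le_of_tendsto ((hc.tendsto ((s + t) / 2)).mono_left
        (nhdsWithin_le_nhds (s := Set.Iio ((s + t) / 2)))) ?_
      filter_upwards [self_mem_nhdsWithin] with r hr
      have hr' : r < (s + t) / 2 := hr
      exact h1 _ _ _ (by linarith)
  -- Jensen's equation at `(s, t)` and at `(s + t, 0)` makes `g - g 0` additive; continuity makes it
  -- linear.
  let G : ℝ →+ ℝ :=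
    { toFun := fun t => g t - g 0
      map_zero' := by simp
      map_add' := fun s t => by
        have e1 := hmid s t
        have e2 := hmid (s + t) 0
        rw [add_zero] at e2
        linarith }
  have hG : Continuous G := by
    change Continuous fun t => g t - g 0
    fun_prop
  have := (G.toRealLinearMap hG).map_smul t 1
  simp only [smul_eq_mul, mul_one, AddMonoidHom.coe_toRealLinearMap] at this
  have h' : g t - g 0 = t * (g 1 - g 0) := this
  linarith

theorem eq_rpow_of_sq_le {F : ℝ → ℝ} (hF : ∀ x, 0 < x → 0 < F x)
    (h1 : ∀ a b c, 0 < a → 0 < b → 0 < c → b ^ 2 < a * c → F b ^ 2 ≤ F a * F c)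
    (h2 : ∀ a b c, 0 < a → 0 < b → 0 < c → a * c < b ^ 2 → F a * F c ≤ F b ^ 2) :
    ∃ α β : ℝ, 0 < α ∧ ∀ x, 0 < x → F x = α * x ^ β := by
  have hpos : ∀ t, 0 < F (Real.exp t) := fun t => hF _ (Real.exp_pos t)
  have key := eq_affine_of_strict_midpoint (g := fun t => Real.log (F (Real.exp t)))
    (fun r s t h => by
      have := Real.log_le_log (by have := hpos r; positivity)
        (h1 _ _ _ (Real.exp_pos s) (Real.exp_pos r) (Real.exp_pos t) (by
          rw [← Real.exp_add, ← Real.exp_nat_mul, Real.exp_lt_exp]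
          exact_mod_cast h))
      rw [Real.log_mul (hpos s).ne' (hpos t).ne', Real.log_pow] at this
      exact_mod_cast this)
    (fun r s t h => by
      have := Real.log_le_log (mul_pos (hpos s) (hpos t))
        (h2 _ _ _ (Real.exp_pos s) (Real.exp_pos r) (Real.exp_pos t) (by
          rw [← Real.exp_add, ← Real.exp_nat_mul, Real.exp_lt_exp]
          exact_mod_cast h))
      rw [Real.log_mul (hpos s).ne' (hpos t).ne', Real.log_pow] at this
      exact_mod_cast this)
  refine ⟨F (Real.exp 0), Real.log (F (Real.exp 1)) - Real.log (F (Real.exp 0)), hpos 0, fun x hx => ?_⟩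
  have hk := key (Real.log x)
  simp only [Real.exp_log hx] at hk
  rw [Real.rpow_def_of_pos hx]
  nth_rw 1 [← Real.exp_log (hpos 0)]
  rw [← Real.exp_add, ← hk, Real.exp_log (hF x hx)]

/-- The hypothesis is equality in the midpoint inequality for `x ^ β` at `z ≠ 1`. Strict concavity
excludes `β < 1` and strict convexity excludes `β > 1`. -/
theorem rpow_exponent_eq_one {β z : ℝ} (hz0 : 0 ≤ z) (hz1 : z < 1) (hβ : 0 < β)
    (h : (2 / (1 + z)) ^ β * (1 + z ^ β) = 2) : β = 1 := by
  have h' : ((1 + z) / 2) ^ β = (1 + z ^ β) / 2 := by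
    rw [← inv_div, Real.inv_rpow (by positivity)] at h
    have : 0 < ((1 + z) / 2) ^ β := by positivity
    field_simp at h
    linarith
  have harg : (1 / 2 : ℝ) • z + (1 / 2 : ℝ) • (1 : ℝ) = (1 + z) / 2 := by
    simp only [smul_eq_mul]; ring
  rcases lt_trichotomy β 1 with hlt | heq | hgt
  · have := (Real.strictConcaveOn_rpow hβ hlt).2 (Set.mem_Ici.2 hz0) (Set.mem_Ici.2 zero_le_one)
      hz1.ne (by norm_num : (0 : ℝ) < 1 / 2) (by norm_num : (0 : ℝ) < 1 / 2) (by norm_num)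
    rw [harg] at this
    simp only [Real.one_rpow, smul_eq_mul] at this
    linarith
  · exact heq
  · have := (strictConvexOn_rpow hgt).2 (Set.mem_Ici.2 hz0) (Set.mem_Ici.2 zero_le_one)
      hz1.ne (by norm_num : (0 : ℝ) < 1 / 2) (by norm_num : (0 : ℝ) < 1 / 2) (by norm_num)
    rw [harg] at this
    simp only [Real.one_rpow, smul_eq_mul] at this
    linarith

theorem eq_zero_and_eq_zero_of_sq_add_sq {p q : ℝ} (h : p ^ 2 + q ^ 2 = 0) : p = 0 ∧ q = 0 :=
  ⟨by nlinarith [sq_nonneg p, sq_nonneg q], by nlinarith [sq_nonneg p, sq_nonneg q]⟩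

/-! ### Test matrices of size 2 and 3 -/

theorem posDef_fin_two {a c : ℝ} {z : ℂ} (ha : 0 < a) (h : ‖z‖ ^ 2 < a * c) :
    (!![(a : ℂ), z; star z, (c : ℂ)] : Matrix (Fin 2) (Fin 2) ℂ).PosDef := by
  have hH : (!![(a : ℂ), z; star z, (c : ℂ)] : Matrix (Fin 2) (Fin 2) ℂ).IsHermitian := by
    ext i j
    fin_cases i <;> fin_cases j <;> simp
  refine posDef_of_re_pos hH fun x hx => ?_
  have hz : ‖z‖ ^ 2 = z.re ^ 2 + z.im ^ 2 := by
    rw [← Complex.normSq_eq_norm_sq, Complex.normSq_apply]; ring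
  rw [hz] at h
  set p := (x 0).re; set q := (x 0).im; set r := (x 1).re; set s := (x 1).im
  have e : (star x ⬝ᵥ (!![(a : ℂ), z; star z, (c : ℂ)] *ᵥ x)).re * a =
      (a * p + z.re * r - z.im * s) ^ 2 + (a * q + z.re * s + z.im * r) ^ 2
        + (a * c - (z.re ^ 2 + z.im ^ 2)) * (r ^ 2 + s ^ 2) := by
    simp [dotProduct, mulVec, Fin.sum_univ_two, p, q, r, s]
    ring
  refine pos_of_mul_pos_left ?_ ha.le
  rw [e]
  by_cases hrs : r ^ 2 + s ^ 2 = 0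
  · obtain ⟨hr, hs⟩ := eq_zero_and_eq_zero_of_sq_add_sq hrs
    have hpq : p ^ 2 + q ^ 2 ≠ 0 := fun h0 => hx (by
      obtain ⟨hp, hq⟩ := eq_zero_and_eq_zero_of_sq_add_sq h0
      funext i
      fin_cases i
      · exact Complex.ext hp hq
      · exact Complex.ext hr hs)
    have : 0 < p ^ 2 + q ^ 2 := lt_of_le_of_ne (by positivity) hpq.symm
    have : 0 < a ^ 2 * (p ^ 2 + q ^ 2) := by positivity
    rw [hr, hs]
    nlinarith
  · have : 0 < r ^ 2 + s ^ 2 := lt_of_le_of_ne (by positivity) (Ne.symm hrs)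
    have : 0 < (a * c - (z.re ^ 2 + z.im ^ 2)) * (r ^ 2 + s ^ 2) := mul_pos (by linarith) this
    positivity

theorem posSemidef_fin_two {A : Matrix (Fin 2) (Fin 2) ℂ} (hA : A.PosSemidef) :
    ∃ a c : ℝ, 0 ≤ a ∧ 0 ≤ c ∧ A 0 0 = a ∧ A 1 1 = c ∧ A 1 0 = star (A 0 1) ∧
      ‖A 0 1‖ ^ 2 ≤ a * c := by
  have h0 := Complex.nonneg_iff.1 (hA.diag_nonneg (i := 0))
  have h1 := Complex.nonneg_iff.1 (hA.diag_nonneg (i := 1))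
  have e0 : A 0 0 = ((A 0 0).re : ℂ) := Complex.ext rfl (by simpa using h0.2.symm)
  have e1 : A 1 1 = ((A 1 1).re : ℂ) := Complex.ext rfl (by simpa using h1.2.symm)
  have e01 : A 1 0 = star (A 0 1) := (hA.isHermitian.apply 1 0).symm
  refine ⟨(A 0 0).re, (A 1 1).re, h0.1, h1.1, e0, e1, e01, ?_⟩
  have hd : 0 ≤ A 0 0 * A 1 1 - A 0 1 * A 1 0 := by
    rw [← det_fin_two]
    exact hA.det_nonneg
  rw [e01, RCLike.star_def, Complex.mul_conj, Complex.normSq_eq_norm_sq, e0, e1,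
    ← Complex.ofReal_mul, ← Complex.ofReal_sub] at hd
  have := Complex.zero_le_real.1 hd
  linarith

/-- The matrix with rows `(1, 1, z)`, `(1, b, 1)`, `(z, 1, 1)`. -/
def bowMatrix (b z : ℂ) : Matrix (Fin 3) (Fin 3) ℂ := !![1, 1, z; 1, b, 1; z, 1, 1]

theorem bowMatrix_isHermitian (b z : ℝ) : (bowMatrix b z).IsHermitian := by
  ext i j
  fin_cases i <;> fin_cases j <;> simp [bowMatrix]

/-- Completing squares in `x 0 + x 2` and `x 0 - x 2` leaves the coefficient `b * (1 + z) - 2`,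
which decides definiteness for `0 ≤ z < 1`. -/
theorem bowMatrix_form (b z : ℝ) (x : Fin 3 → ℂ) :
    (star x ⬝ᵥ (bowMatrix b z *ᵥ x)).re * (2 * (1 + z)) =
      ((1 + z) * ((x 0).re + (x 2).re) + 2 * (x 1).re) ^ 2
      + ((1 + z) * ((x 0).im + (x 2).im) + 2 * (x 1).im) ^ 2
      + (1 - z) * (1 + z) * (((x 0).re - (x 2).re) ^ 2 + ((x 0).im - (x 2).im) ^ 2)
      + 2 * (b * (1 + z) - 2) * ((x 1).re ^ 2 + (x 1).im ^ 2) := by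
  simp [bowMatrix, dotProduct, mulVec, Fin.sum_univ_three]
  ring

theorem bowMatrix_posDef {b z : ℝ} (hz0 : 0 ≤ z) (hz1 : z < 1) (h : 2 < b * (1 + z)) :
    (bowMatrix b z).PosDef := by
  refine posDef_of_re_pos (bowMatrix_isHermitian b z) fun x hx => ?_
  refine pos_of_mul_pos_left (b := 2 * (1 + z)) ?_ (by positivity)
  rw [bowMatrix_form]
  have h2 : 0 < (1 - z) * (1 + z) := mul_pos (by linarith) (by linarith)
  have h3 : 0 < 2 * (b * (1 + z) - 2) := by linarith
  have h4 : 0 < 1 + z := by linarith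
  have hA := sq_nonneg ((1 + z) * ((x 0).re + (x 2).re) + 2 * (x 1).re)
  have hB := sq_nonneg ((1 + z) * ((x 0).im + (x 2).im) + 2 * (x 1).im)
  have hC := mul_nonneg h2.le
    (add_nonneg (sq_nonneg ((x 0).re - (x 2).re)) (sq_nonneg ((x 0).im - (x 2).im)))
  have hD := mul_nonneg h3.le (add_nonneg (sq_nonneg (x 1).re) (sq_nonneg (x 1).im))
  refine lt_of_le_of_ne (by linarith) fun h0 => hx ?_
  obtain ⟨r1, i1⟩ := eq_zero_and_eq_zero_of_sq_add_sq
    ((mul_eq_zero.1 (by linarith : 2 * (b * (1 + z) - 2) * ((x 1).re ^ 2 + (x 1).im ^ 2) = 0)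
      ).resolve_left h3.ne')
  obtain ⟨rd, idd⟩ := eq_zero_and_eq_zero_of_sq_add_sq
    ((mul_eq_zero.1 (by linarith : (1 - z) * (1 + z) *
      (((x 0).re - (x 2).re) ^ 2 + ((x 0).im - (x 2).im) ^ 2) = 0)).resolve_left h2.ne')
  obtain ⟨rs, is⟩ := eq_zero_and_eq_zero_of_sq_add_sq
    (by linarith : ((1 + z) * ((x 0).re + (x 2).re) + 2 * (x 1).re) ^ 2 +
      ((1 + z) * ((x 0).im + (x 2).im) + 2 * (x 1).im) ^ 2 = 0)
  rw [r1, mul_zero, add_zero, mul_eq_zero] at rs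
  rw [i1, mul_zero, add_zero, mul_eq_zero] at is
  have rs' := rs.resolve_left h4.ne'
  have is' := is.resolve_left h4.ne'
  have r0 : (x 0).re = 0 := by linarith
  have i0 : (x 0).im = 0 := by linarith
  have r2 : (x 2).re = 0 := by linarith
  have i2 : (x 2).im = 0 := by linarith
  funext i
  fin_cases i
  · exact Complex.ext r0 i0
  · exact Complex.ext r1 i1
  · exact Complex.ext r2 i2

theorem le_of_bowMatrix_posSemidef {b z : ℝ} (hz0 : 0 ≤ z) (h : (bowMatrix b z).PosSemidef) :
    2 ≤ b * (1 + z) := by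
  -- This vector kills every square in `bowMatrix_form` except the one multiplied by `b * (1 + z) -
  -- 2`.
  have := h.re_dotProduct_nonneg ![1, -(1 + z : ℝ), 1]
  have e := bowMatrix_form b z ![1, -(1 + z : ℝ), 1]
  simp only [RCLike.re_eq_complex_re] at this
  have h2 := mul_nonneg this (by positivity : 0 ≤ 2 * (1 + z))
  rw [e] at h2
  simp at h2
  by_contra! hlt
  have : 0 < (1 + z) ^ 2 := by positivity
  nlinarith

theorem posSemidef_ofReal_smul_iff {ι : Type*} {A : Matrix ι ι ℂ} {α : ℝ} (hα : 0 < α) :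
    ((α : ℂ) • A).PosSemidef ↔ A.PosSemidef := by
  refine ⟨fun h => ?_, fun h => h.smul (by simpa using hα.le)⟩
  have := h.smul (a := ((α⁻¹ : ℝ) : ℂ)) (by simpa using hα.le)
  rwa [smul_smul, ← Complex.ofReal_mul, inv_mul_cancel₀ hα.ne', Complex.ofReal_one, one_smul] at this

theorem posDef_ofReal_smul_iff {ι : Type*} {A : Matrix ι ι ℂ} {α : ℝ} (hα : 0 < α) :
    ((α : ℂ) • A).PosDef ↔ A.PosDef := by
  refine ⟨fun h => ?_, fun h => h.smul (by simpa using hα)⟩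
  have := h.smul (a := ((α⁻¹ : ℝ) : ℂ)) (by simpa using hα)
  rwa [smul_smul, ← Complex.ofReal_mul, inv_mul_cancel₀ hα.ne', Complex.ofReal_one, one_smul] at this

theorem pair_injective {V : Type*} {G : SimpleGraph V} {u v : V} (huv : G.Adj u v) : Function.Injective ![u, v] := by
  intro i j h
  fin_cases i <;> fin_cases j <;> simp_all [huv.ne, huv.ne.symm]

/-! ### The function on the positive half-line -/

section

variable {V : Type*} [Fintype V] {G : SimpleGraph V} {Ω : Set ℂ} {f : ℂ → ℂ} {u v w : V}

theorem pair_mem_graphMatrices {H : SimpleGraph (Fin 2)} (h : H.Adj 0 1)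
    {C : Matrix (Fin 2) (Fin 2) ℂ} (hC : ∀ i j, C i j ∈ Ω) : C ∈ graphMatrices H Ω := by
  rw [mem_graphMatrices_iff]
  refine fun i j => ⟨fun hn => absurd ?_ hn, fun _ => hC i j⟩
  fin_cases i <;> fin_cases j <;> simp [h, h.symm]

theorem pair_graphMap {H : SimpleGraph (Fin 2)} (h : H.Adj 0 1) (f : ℂ → ℂ)
    (C : Matrix (Fin 2) (Fin 2) ℂ) : graphMap H f C = C.map f := by
  ext i j
  rw [graphMap_apply_of, map_apply]
  fin_cases i <;> fin_cases j <;> simp [h, h.symm]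

theorem IsWeakSignPreserver.of_norm_sq_lt (hf : IsWeakSignPreserver G Ω f)
    (hΩ : ∀ x : ℝ, 0 < x → (x : ℂ) ∈ Ω) (huv : G.Adj u v) {a c : ℝ} {z : ℂ} (ha : 0 < a)
    (hc : 0 < c) (hz : z ∈ Ω) (hz' : star z ∈ Ω) (h : ‖z‖ ^ 2 < a * c) :
    ∃ a' c' : ℝ, 0 ≤ a' ∧ 0 ≤ c' ∧ f a = a' ∧ f c = c' ∧ f (star z) = star (f z) ∧
      ‖f z‖ ^ 2 ≤ a' * c' := by
  have hH : (G.comap ![u, v]).Adj 0 1 := huv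
  have := hf.posSemidef_graphMap_comap hΩ (pair_injective huv)
    (pair_mem_graphMatrices hH (C := !![(a : ℂ), z; star z, (c : ℂ)]) (by
      intro i j
      fin_cases i <;> fin_cases j
      exacts [hΩ a ha, hz, hz', hΩ c hc])) (posDef_fin_two ha h)
  rw [pair_graphMap hH] at this
  simpa using posSemidef_fin_two this

theorem IsWeakSignPreserver.norm_sq_le_of (hf : IsWeakSignPreserver G Ω f)
    (hΩ : ∀ x : ℝ, 0 < x → (x : ℂ) ∈ Ω) (h1 : star (f 1) = f 1)
    (hunb : ∀ K : ℝ, ∃ x y : ℝ, 0 < x ∧ K ≤ y ∧ f x = y) (huv : G.Adj u v) {a c a' c' : ℝ} {z : ℂ}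
    (ha : (a : ℂ) ∈ Ω) (hc : (c : ℂ) ∈ Ω) (hz : z ∈ Ω) (hz' : star z ∈ Ω) (hfa : f a = a')
    (hfc : f c = c') (hfz : f (star z) = star (f z)) (ha' : 0 < a') (h : ‖f z‖ ^ 2 < a' * c') :
    0 ≤ a ∧ ‖z‖ ^ 2 ≤ a * c := by
  have hH : (G.comap ![u, v]).Adj 0 1 := huv
  have hherm : (!![(a : ℂ), z; star z, (c : ℂ)] : Matrix (Fin 2) (Fin 2) ℂ).IsHermitian := by
    ext i j
    fin_cases i <;> fin_cases j <;> simp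
  have := hf.posSemidef_of_graphMap_comap hΩ h1 hunb (pair_injective huv)
    (pair_mem_graphMatrices hH (C := !![(a : ℂ), z; star z, (c : ℂ)]) (by
      intro i j
      fin_cases i <;> fin_cases j
      exacts [ha, hz, hz', hc])) hherm (by
        rw [pair_graphMap hH]
        convert posDef_fin_two ha' h using 1
        ext i j
        fin_cases i <;> fin_cases j
        exacts [hfa, rfl, hfz, hfc])
  obtain ⟨a₁, c₁, ha₁, -, e1, e2, -, hle⟩ := posSemidef_fin_two this
  have e1' : a = a₁ := Complex.ofReal_injective e1
  have e2' : c = c₁ := Complex.ofReal_injective e2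
  rw [e1', e2']
  exact ⟨ha₁, hle⟩

/-- On the positive half-line the function is real, nonnegative and satisfies the `2 × 2`
inequality. -/
theorem IsWeakSignPreserver.re_sq_le (hf : IsWeakSignPreserver G Ω f)
    (hΩ : ∀ x : ℝ, 0 < x → (x : ℂ) ∈ Ω) (huv : G.Adj u v) :
    (∀ x : ℝ, 0 < x → f x = (f x).re ∧ 0 ≤ (f x).re) ∧
    ∀ a b c : ℝ, 0 < a → 0 < b → 0 < c → b ^ 2 < a * c → (f b).re ^ 2 ≤ (f a).re * (f c).re := by
  have key : ∀ a b c : ℝ, 0 < a → 0 < b → 0 < c → b ^ 2 < a * c →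
      f a = (f a).re ∧ 0 ≤ (f a).re ∧ (f b).re ^ 2 ≤ (f a).re * (f c).re := by
    intro a b c ha hb hc h
    have hb' : star (b : ℂ) ∈ Ω := by simpa using hΩ b hb
    obtain ⟨a', c', ha', hc', e1, e2, -, hle⟩ :=
      hf.of_norm_sq_lt hΩ huv ha hc (hΩ b hb) hb' (by simpa using h)
    rw [e1, e2, Complex.ofReal_re, Complex.ofReal_re]
    refine ⟨rfl, ha', le_trans ?_ hle⟩
    rw [← Complex.normSq_eq_norm_sq, Complex.normSq_apply]
    nlinarith [mul_self_nonneg (f b).im]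
  refine ⟨fun x hx => ?_, fun a b c ha hb hc h => (key a b c ha hb hc h).2.2⟩
  obtain ⟨h1, h2, -⟩ := key x x (2 * x) hx hx (by linarith) (by nlinarith)
  exact ⟨h1, h2⟩

/-- A nonnegative nonconstant function on the half-line with the strict `2 × 2` inequality is
positive and unbounded. -/
theorem pos_and_unbounded_of_sq_le {F : ℝ → ℝ} (h0 : ∀ x, 0 < x → 0 ≤ F x)
    (h1 : ∀ a b c : ℝ, 0 < a → 0 < b → 0 < c → b ^ 2 < a * c → F b ^ 2 ≤ F a * F c)
    (hnc : ∃ x y : ℝ, 0 < x ∧ 0 < y ∧ F x ≠ F y) :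
    (∀ x, 0 < x → 0 < F x) ∧ ∀ K : ℝ, ∃ x, 0 < x ∧ K ≤ F x := by
  obtain ⟨x₀, y₀, hx₀, hy₀, hne⟩ := hnc
  have hex : ∀ a b : ℝ, 0 < a → 0 < b → ∃ c, 0 < c ∧ b ^ 2 < a * c := by
    intro a b ha hb
    refine ⟨(b ^ 2 + 1) / a, by positivity, ?_⟩
    rw [mul_div_cancel₀ _ ha.ne']
    linarith
  refine ⟨fun x hx => lt_of_le_of_ne (h0 x hx) fun hx0 => hne ?_, ?_⟩
  · have hz : ∀ b, 0 < b → F b = 0 := by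
      intro b hb
      obtain ⟨c, hc, hbc⟩ := hex x b hx hb
      have := h1 x b c hx hb hc hbc
      rw [← hx0, zero_mul] at this
      exact pow_eq_zero_iff two_ne_zero |>.1 (le_antisymm this (sq_nonneg _))
    rw [hz x₀ hx₀, hz y₀ hy₀]
  · by_contra! hK
    -- For a bounded `F` with supremum `S`, choosing `c` large gives `F b ^ 2 ≤ F a * S` for all
    -- `b`. Hence `S ^ 2 ≤ F a * S`, so every `F a` equals `S`.
    obtain ⟨K, hK⟩ := hK
    let S : Set ℝ := F '' Set.Ioi 0
    have hS : BddAbove S := ⟨K, by rintro _ ⟨x, hx, rfl⟩; exact (hK x hx).le⟩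
    have hle : ∀ x, 0 < x → F x ≤ sSup S := fun x hx => le_csSup hS ⟨x, hx, rfl⟩
    have hs0 : 0 ≤ sSup S := (h0 1 one_pos).trans (hle 1 one_pos)
    have heq : ∀ a, 0 < a → F a = sSup S := by
      intro a ha
      refine le_antisymm (hle a ha) ?_
      have h2 : ∀ b, 0 < b → F b ≤ √(F a * sSup S) := by
        intro b hb
        obtain ⟨c, hc, hbc⟩ := hex a b ha hb
        exact Real.le_sqrt_of_sq_le ((h1 a b c ha hb hc hbc).trans
          (mul_le_mul_of_nonneg_left (hle c hc) (h0 a ha)))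
      have h3 : sSup S ≤ √(F a * sSup S) :=
        csSup_le ⟨F 1, 1, Set.mem_Ioi.2 one_pos, rfl⟩ (by rintro _ ⟨x, hx, rfl⟩; exact h2 x hx)
      have h4 := pow_le_pow_left₀ hs0 h3 2
      rw [Real.sq_sqrt (mul_nonneg (h0 a ha) hs0)] at h4
      rcases hs0.eq_or_lt with hs | hs
      · rw [← hs]; exact h0 a ha
      · nlinarith
    exact hne ((heq x₀ hx₀).trans (heq y₀ hy₀).symm)

/-- `Q` stands for either kind of positivity. If `f` were constant on `(0, ∞)`, two matrices would
have the same image: edges 1 with a large diagonal, which is definite, and edges 2 with diagonal 1,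
which has a negative 2 × 2 minor. -/
theorem not_const_of_separates (huv : G.Adj u v) {Q : Matrix V V ℂ → Prop}
    (hΩ : ∀ x : ℝ, 0 < x → (x : ℂ) ∈ Ω) (hQ : ∀ A : Matrix V V ℂ, A.PosDef → Q A)
    (hQ' : ∀ A : Matrix V V ℂ, Q A → A.PosSemidef)
    (hf : ∀ A ∈ graphMatrices G Ω, A.IsHermitian → (Q A ↔ Q (graphMap G f A))) :
    ∃ x y : ℝ, 0 < x ∧ 0 < y ∧ f x ≠ f y := by
  by_contra! hc
  have he : Function.Injective (Empty.elim : Empty → V) := fun i => i.elim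
  have hmem : ∀ c d : ℝ, 0 < c → 0 < d →
      pad G (Empty.elim : Empty → V) 0 c d ∈ graphMatrices G Ω := fun c d h h' =>
    pad_mem_graphMatrices he (fun i => i.elim) (hΩ c h) (hΩ d h')
  have hherm : ∀ c d : ℝ, (pad G (Empty.elim : Empty → V) 0 c d).IsHermitian := fun c d =>
    pad_isHermitian he (isHermitian_zero) (Complex.conj_ofReal c) (Complex.conj_ofReal d)
  obtain ⟨T₀, hT₀⟩ := exists_pad_posDef (G := G) (C := 0) (c := ((1 : ℝ) : ℂ)) he
    (posDef_of_re_pos isHermitian_zero fun x hx => absurd (Subsingleton.elim _ _) hx)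
    (fun i => i.elim) (Complex.conj_ofReal 1)
  have hTpos : 0 < max T₀ 1 := by positivity
  have hq := hQ _ (hT₀ (max T₀ 1) (le_max_left _ _))
  rw [hf _ (hmem 1 _ one_pos hTpos) (hherm _ _), graphMap_pad he, hc _ 1 hTpos one_pos,
    hc 1 2 one_pos two_pos, ← hc 1 2 one_pos two_pos] at hq
  have e := graphMap_pad (G := G) (C := 0) (c := ((2 : ℝ) : ℂ)) (d := ((1 : ℝ) : ℂ)) he f
  rw [← hc 1 2 one_pos two_pos] at e
  rw [← e, ← hf _ (hmem 2 1 two_pos one_pos) (hherm _ _)] at hq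
  have hs := (hQ' _ hq).submatrix ![u, v]
  obtain ⟨a, c, -, -, e1, e2, -, hle⟩ := posSemidef_fin_two hs
  have hr : ∀ x : V, x ∉ Set.range (Empty.elim : Empty → V) := fun x ⟨y, _⟩ => y.elim
  simp only [submatrix_apply, cons_val_zero, cons_val_one] at e1 e2 hle
  rw [pad_apply_self_of_notMem (hr _)] at e1 e2
  rw [pad_apply_adj huv fun h => hr u h.1, ← Complex.ofReal_injective e1,
    ← Complex.ofReal_injective e2] at hle
  norm_num at hle

/-- Without such a path every vertex has at most one neighbour, so the two ends of an edge are
closed under walks and exhaust the graph. -/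
theorem exists_adj_adj_of_connected (hG : G.Connected) (hn : 3 ≤ Fintype.card V) :
    ∃ u v w : V, G.Adj u v ∧ G.Adj v w ∧ u ≠ w := by
  classical
  by_contra! h
  obtain ⟨v⟩ := hG.nonempty
  have hnt : Nontrivial V := Fintype.one_lt_card_iff_nontrivial.1 (by omega)
  obtain ⟨u, hu⟩ := hG.preconnected.exists_adj_of_nontrivial v
  have hcl : ∀ a b : V, G.Walk a b → (a = v ∨ a = u) → (b = v ∨ b = u) := by
    intro a b p
    induction p with
    | nil => exact id
    | cons hadj q ih =>
      rename_i x y z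
      intro hx
      refine ih ?_
      rcases hx with rfl | rfl
      · exact Or.inr (h y x u hadj.symm hu)
      · exact Or.inl (h y x v hadj.symm hu.symm)
  have : Fintype.card V ≤ 2 := by
    rw [← Finset.card_univ]
    refine (Finset.card_le_card (t := {v, u}) fun b _ => ?_).trans Finset.card_le_two
    obtain ⟨p⟩ := hG.preconnected v b
    simpa using hcl v b p (Or.inl rfl)
  omega

/-- A function that weakly preserves signs and is not constant on `(0, ∞)` is a positive multiple
of the identity there. -/
theorem IsWeakSignPreserver.eq_mul_of_pos (hf : IsWeakSignPreserver G Ω f)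
    (hΩ : ∀ x : ℝ, 0 < x → (x : ℂ) ∈ Ω) (hnc : ∃ x y : ℝ, 0 < x ∧ 0 < y ∧ f x ≠ f y)
    (huv : G.Adj u v) (hvw : G.Adj v w) (huw : u ≠ w) :
    ∃ α : ℝ, 0 < α ∧ ∀ x : ℝ, 0 < x → f x = (α * x : ℝ) := by
  obtain ⟨hre, hsq⟩ := hf.re_sq_le hΩ huv
  obtain ⟨hpos, hunb⟩ := pos_and_unbounded_of_sq_le (F := fun x : ℝ => (f x).re)
    (fun x hx => (hre x hx).2) hsq (by
      obtain ⟨x, y, hx, hy, hne⟩ := hnc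
      exact ⟨x, y, hx, hy, fun h => hne (by rw [(hre x hx).1, (hre y hy).1, h])⟩)
  have hstar : ∀ x : ℝ, 0 < x → star (f x) = f x := fun x hx => by
    rw [(hre x hx).1]; exact Complex.conj_ofReal _
  have h1 : star (f 1) = f 1 := by simpa using hstar 1 one_pos
  have hunb' : ∀ K : ℝ, ∃ x y : ℝ, 0 < x ∧ K ≤ y ∧ f x = y := fun K => by
    obtain ⟨x, hx, hK⟩ := hunb K
    exact ⟨x, _, hx, hK, (hre x hx).1⟩
  obtain ⟨α, β, hα, hF⟩ := eq_rpow_of_sq_le hpos hsq fun a b c ha hb hc h => by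
    by_contra! hlt
    have hb' : star (b : ℂ) = b := Complex.conj_ofReal b
    have := (hf.norm_sq_le_of hΩ h1 hunb' huv (hΩ a ha) (hΩ c hc) (hΩ b hb)
      (by rw [hb']; exact hΩ b hb) (hre a ha).1 (hre c hc).1
      (by rw [hb', hstar b hb]) (hpos a ha) (by
        rw [(hre b hb).1, Complex.norm_real, Real.norm_eq_abs, sq_abs]
        exact hlt)).2
    rw [Complex.norm_real, Real.norm_eq_abs, sq_abs] at this
    linarith
  have hfx : ∀ x : ℝ, 0 < x → f x = (α * x ^ β : ℝ) := fun x hx => by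
    rw [(hre x hx).1, hF x hx]
  -- Comparing the values at 1 and 2 excludes `β < 0`; nonconstancy then excludes `β = 0`.
  have hmono : (f (1 : ℝ)).re ≤ (f (2 : ℝ)).re := by
    have := hsq 2 1 2 two_pos one_pos two_pos (by norm_num)
    have := hpos 2 two_pos
    nlinarith
  have hβ : 0 < β := by
    refine lt_of_le_of_ne ?_ fun h0 => ?_
    · by_contra! hneg
      have h2 := Real.rpow_lt_one_of_one_lt_of_neg (by norm_num : (1 : ℝ) < 2) hneg
      have e1 := hF 1 one_pos
      have e2 := hF 2 two_pos
      rw [Real.one_rpow] at e1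
      nlinarith
    · obtain ⟨x, y, hx, hy, hne⟩ := hnc
      exact hne (by rw [hfx x hx, hfx y hy, ← h0, Real.rpow_zero, Real.rpow_zero])
  -- The pattern forces the corner entry to be 0 when `u`, `w` are not adjacent. When they are, it
  -- must be positive to lie in `Ω`, and any value below 1 would do.
  obtain ⟨z, hz0, hz1, hzadj, hzn⟩ : ∃ z : ℝ, 0 ≤ z ∧ z < 1 ∧ (G.Adj u w → 0 < z) ∧
      (¬ G.Adj u w → z = 0) := by
    by_cases h : G.Adj u w
    · exact ⟨1 / 2, by norm_num, by norm_num, fun _ => by norm_num, fun h' => absurd h h'⟩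
    · exact ⟨0, le_rfl, one_pos, fun h' => absurd h' h, fun _ => rfl⟩
  have he : Function.Injective ![u, v, w] := by
    intro i j h
    fin_cases i <;> fin_cases j <;>
      simp_all [huv.ne, huv.ne.symm, hvw.ne, hvw.ne.symm, huw.symm]
  have hmem : ∀ b : ℝ, 0 < b → bowMatrix b z ∈ graphMatrices (G.comap ![u, v, w]) Ω := by
    intro b hb
    have h1Ω : (1 : ℂ) ∈ Ω := by simpa using hΩ 1 one_pos
    rw [mem_graphMatrices_iff]
    intro i j
    by_cases huw' : G.Adj u w
    · have := hΩ z (hzadj huw')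
      fin_cases i <;> fin_cases j <;>
        simp [bowMatrix, huv, huv.symm, hvw, hvw.symm, huw', huw'.symm, hΩ b hb, h1Ω, this]
    · have huw'' : ¬ G.Adj w u := fun h => huw' h.symm
      have := hzn huw'
      fin_cases i <;> fin_cases j <;>
        simp [bowMatrix, huv, huv.symm, hvw, hvw.symm, huw', huw'', hΩ b hb, h1Ω, this]
  have hmap : ∀ b : ℝ, 0 < b → graphMap (G.comap ![u, v, w]) f (bowMatrix b z) =
      (α : ℂ) • bowMatrix ((b ^ β : ℝ) : ℂ) ((z ^ β : ℝ) : ℂ) := by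
    intro b hb
    have hf1 : f 1 = α := by simpa using hfx 1 one_pos
    have hfb : f b = α * ((b ^ β : ℝ) : ℂ) := by rw [hfx b hb, Complex.ofReal_mul]
    ext i j
    by_cases huw' : G.Adj u w
    · have hfz : f z = α * ((z ^ β : ℝ) : ℂ) := by rw [hfx z (hzadj huw'), Complex.ofReal_mul]
      fin_cases i <;> fin_cases j <;>
        simp [graphMap, bowMatrix, huv, huv.symm, hvw, hvw.symm, huw', huw'.symm, hf1, hfb, hfz]
    · have huw'' : ¬ G.Adj w u := fun h => huw' h.symm
      have := hzn huw'
      fin_cases i <;> fin_cases j <;>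
        simp [graphMap, bowMatrix, huv, huv.symm, hvw, hvw.symm, huw', huw'', hf1, hfb, this,
          Real.zero_rpow hβ.ne']
  have hz0' : 0 ≤ z ^ β := Real.rpow_nonneg hz0 β
  have hz1' : z ^ β < 1 := Real.rpow_lt_one hz0 hz1 hβ
  have hweak := hf.comap hΩ h1 hunb' he
  have hfwd : ∀ b : ℝ, 0 < b → 2 < b * (1 + z) → 2 ≤ b ^ β * (1 + z ^ β) := by
    intro b hb h
    have := (hweak _ (hmem b hb) (bowMatrix_isHermitian b z)).1 (bowMatrix_posDef hz0 hz1 h)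
    rw [hmap b hb, posSemidef_ofReal_smul_iff hα] at this
    exact le_of_bowMatrix_posSemidef hz0' this
  have hbwd : ∀ b : ℝ, 0 < b → 2 < b ^ β * (1 + z ^ β) → 2 ≤ b * (1 + z) := by
    intro b hb h
    refine le_of_bowMatrix_posSemidef hz0
      ((hweak _ (hmem b hb) (bowMatrix_isHermitian b z)).2 ?_)
    rw [hmap b hb, posDef_ofReal_smul_iff hα]
    exact bowMatrix_posDef hz0' hz1' h
  have hb0 : 0 < 2 / (1 + z) := by positivity
  have hcont : ContinuousAt (fun b : ℝ => b ^ β * (1 + z ^ β)) (2 / (1 + z)) :=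
    (Real.continuousAt_rpow_const _ _ (Or.inl hb0.ne')).mul continuousAt_const
  -- The source matrix changes sign at `b = 2 / (1 + z)`. Approaching this value from both sides
  -- puts the image at its own threshold.
  have heq : (2 / (1 + z)) ^ β * (1 + z ^ β) = 2 := by
    refine le_antisymm ?_ ?_
    · refine le_of_tendsto (hcont.tendsto.mono_left
        (nhdsWithin_le_nhds (s := Set.Iio (2 / (1 + z))))) ?_
      filter_upwards [self_mem_nhdsWithin, nhdsWithin_le_nhds (lt_mem_nhds hb0)] with b hb hbpos
      have hb' : b * (1 + z) < 2 := (lt_div_iff₀ (by positivity)).1 hb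
      by_contra! h
      exact absurd (hbwd b hbpos h) hb'.not_ge
    · refine ge_of_tendsto (hcont.tendsto.mono_left
        (nhdsWithin_le_nhds (s := Set.Ioi (2 / (1 + z))))) ?_
      filter_upwards [self_mem_nhdsWithin] with b hb
      exact hfwd b (hb0.trans hb) ((div_lt_iff₀ (by positivity)).1 hb)
  have hβ1 := rpow_exponent_eq_one hz0 hz1 hβ heq
  exact ⟨α, hα, fun x hx => by rw [hfx x hx, hβ1, Real.rpow_one]⟩

end

/-! ### Moduli and conjugation on all of `Ω` -/

/-- On real points of `Ω` the function is `x ↦ α x`, and on all of `Ω` it commutes with complex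
conjugation and scales the modulus by `α`. -/
def IsModulusLinearOn (Ω : Set ℂ) (f : ℂ → ℂ) (α : ℝ) : Prop :=
  (∀ x : ℝ, (x : ℂ) ∈ Ω → f x = (α * x : ℝ)) ∧
    ∀ z ∈ Ω, ‖f z‖ = α * ‖z‖ ∧ f (star z) = star (f z)

/-- At real points the modulus and conjugation rules already follow from `f x = α x`. -/
theorem isPowerTypeOn_one_iff {Ω : Set ℂ} {f : ℂ → ℂ} {α : ℝ} (hα : 0 < α) :
    IsPowerTypeOn Ω f α 1 ↔ IsModulusLinearOn Ω f α := by
  have hs : ∀ x : ℝ, α * Real.sign x * |x| ^ (1 : ℝ) = α * x := by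
    intro x
    rw [Real.rpow_one, mul_assoc]
    rcases lt_trichotomy x 0 with h | rfl | h
    · rw [Real.sign_of_neg h, abs_of_neg h, neg_one_mul, neg_neg]
    · simp
    · rw [Real.sign_of_pos h, abs_of_pos h, one_mul]
  unfold IsPowerTypeOn IsModulusLinearOn
  simp only [hs]
  simp only [Real.rpow_one]
  refine and_congr_right fun hre => ⟨fun h z hz => ?_, fun h z hz _ => h z hz⟩
  by_cases him : z.im = 0
  · obtain ⟨r, rfl⟩ : ∃ r : ℝ, z = r := ⟨z.re, Complex.ext rfl (by simpa using him)⟩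
    rw [RCLike.star_def, Complex.conj_ofReal, hre _ hz, Complex.norm_real, Complex.norm_real,
      norm_mul, Real.norm_of_nonneg hα.le]
    exact ⟨rfl, (Complex.conj_ofReal _).symm⟩
  · exact h z hz him

theorem IsWeakSignPreserver.isModulusLinearOn {V : Type*} [Fintype V] {G : SimpleGraph V}
    {Ω : Set ℂ} {f : ℂ → ℂ} {u v w : V} (hf : IsWeakSignPreserver G Ω f)
    (hΩ : ∀ x : ℝ, 0 < x → (x : ℂ) ∈ Ω) (hstar : ∀ z ∈ Ω, star z ∈ Ω)
    (hzero : ∀ x : ℝ, x ≤ 0 → (x : ℂ) ∈ Ω → (0 : ℂ) ∈ Ω)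
    (hnc : ∃ x y : ℝ, 0 < x ∧ 0 < y ∧ f x ≠ f y)
    (huv : G.Adj u v) (hvw : G.Adj v w) (huw : u ≠ w) :
    ∃ α : ℝ, 0 < α ∧ IsModulusLinearOn Ω f α := by
  obtain ⟨α, hα, hpos⟩ := hf.eq_mul_of_pos hΩ hnc huv hvw huw
  have h1 : star (f 1) = f 1 := by
    have := hpos 1 one_pos
    rw [Complex.ofReal_one] at this
    rw [this]
    exact Complex.conj_ofReal _
  have hunb : ∀ K : ℝ, ∃ x y : ℝ, 0 < x ∧ K ≤ y ∧ f x = y := fun K =>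
    ⟨max K 1 / α, max K 1, by positivity, le_max_left _ _, by
      rw [hpos _ (by positivity), mul_div_cancel₀ _ hα.ne']⟩
  have hconj : ∀ z ∈ Ω, f (star z) = star (f z) := by
    intro z hz
    obtain ⟨-, -, -, -, -, -, h, -⟩ := hf.of_norm_sq_lt hΩ huv one_pos
      (c := ‖z‖ ^ 2 + 1) (by positivity) hz (hstar z hz) (by linarith)
    exact h
  have hnorm : ∀ z ∈ Ω, ‖f z‖ = α * ‖z‖ := by
    intro z hz
    rw [← sq_eq_sq₀ (norm_nonneg _) (by positivity), mul_pow]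
    -- Both bounds use the 2 × 2 matrix with diagonal `1`, `s / α ^ 2` and off-diagonal entry `z`:
    -- its image has diagonal product exactly `s`.
    refine le_antisymm (le_of_forall_gt_imp_ge_of_dense fun s hs => ?_)
      (le_of_forall_gt_imp_ge_of_dense fun s hs => ?_)
    · have ht : ‖z‖ ^ 2 < s / α ^ 2 := (lt_div_iff₀' (by positivity)).2 hs
      have ht0 : 0 < s / α ^ 2 := lt_of_le_of_lt (sq_nonneg _) ht
      obtain ⟨a', c', -, -, ha, hc, -, h⟩ := hf.of_norm_sq_lt hΩ huv one_pos ht0 hz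
        (hstar z hz) (by simpa using ht)
      rw [hpos 1 one_pos] at ha
      rw [hpos _ ht0] at hc
      rw [← Complex.ofReal_injective ha, ← Complex.ofReal_injective hc] at h
      refine h.trans (le_of_eq ?_)
      field_simp
    · have hs0 : 0 < s := lt_of_le_of_lt (sq_nonneg _) hs
      have ht0 : 0 < s / α ^ 2 := by positivity
      have h := (hf.norm_sq_le_of hΩ h1 hunb huv (hΩ 1 one_pos) (hΩ _ ht0) hz (hstar z hz)
        (hpos 1 one_pos) (hpos _ ht0) (hconj z hz) (by positivity) (by
          refine hs.trans_eq ?_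
          field_simp)).2
      rw [one_mul, le_div_iff₀' (by positivity)] at h
      exact h
  refine ⟨α, hα, fun x hx => ?_, fun z hz => ⟨hnorm z hz, hconj z hz⟩⟩
  rcases lt_or_ge 0 x with hx0 | hx0
  · exact hpos x hx0
  have h0Ω := hzero x hx0 hx
  have hf0 : f 0 = 0 := by simpa using hnorm 0 h0Ω
  have hcx := hconj x hx
  rw [RCLike.star_def, Complex.conj_ofReal] at hcx
  obtain ⟨y, hy⟩ := Complex.conj_eq_iff_real.1 hcx.symm
  have hn := hnorm x hx
  rw [hy, Complex.norm_real, Complex.norm_real, Real.norm_eq_abs, Real.norm_eq_abs,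
    abs_of_nonpos hx0] at hn
  rw [hy]
  -- If `x < 0` had a positive image, `diag(x, 1)` would have a definite image without being
  -- semidefinite.
  rcases abs_choice y with h | h
  · rcases hx0.eq_or_lt with rfl | hneg
    · rw [abs_eq_zero.1 (hn.trans (by simp)), mul_zero]
    · have hy0 : 0 < y := by rw [← h, hn]; nlinarith
      have := (hf.norm_sq_le_of hΩ h1 hunb huv hx (hΩ 1 one_pos) h0Ω (by simpa using h0Ω)
        hy (hpos 1 one_pos) (by simp [hf0]) hy0 (by rw [hf0]; simp; positivity)).1
      linarith
  · congr 1
    linarith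

/-! ### Sufficiency: phases on trees, and positive multiples -/

/-- Let `θ v` be the product of `c` along the unique path from `v` to a root. For adjacent vertices,
one path is the other extended by their edge. -/
theorem exists_potential_of_isTree {V Γ : Type*} [Group Γ] {G : SimpleGraph V} (hG : G.IsTree)
    (c : V → V → Γ) (hc : ∀ i j, G.Adj i j → c j i = (c i j)⁻¹) :
    ∃ θ : V → Γ, ∀ i j, G.Adj i j → c i j = θ i * (θ j)⁻¹ := by
  classical
  obtain ⟨r⟩ := hG.connected.nonempty
  choose p hp using fun v => (hG.existsUnique_path v r).exists
  let φ : ∀ v, G.Walk v r → Γ := fun v q => (q.darts.map fun d => c d.fst d.snd).prod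
  have key : ∀ i j, G.Adj i j → i ∉ (p j).support → c i j = φ i (p i) * (φ j (p j))⁻¹ := by
    intro i j hij hi
    have hpath : (SimpleGraph.Walk.cons hij (p j)).IsPath := (hp j).cons hi
    rw [(hG.existsUnique_path i r).unique (hp i) hpath]
    simp [φ]
  refine ⟨fun v => φ v (p v), fun i j hij => ?_⟩
  by_cases hi : i ∈ (p j).support
  · have hj : j ∉ (p i).support := by
      have := hG.isAcyclic.ne_mem_support_of_support_of_adj_of_isPath (hp j).reverse (hp i).reverse
        hij.symm (by simpa using hi)
      simpa using this
    rw [← _root_.inv_inj, ← hc i j hij, key j i hij.symm hj]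
    simp
  · exact key i j hij hi

theorem posDef_graphMap_iff_of_isTree {V : Type*} [Fintype V] {G : SimpleGraph V} (hG : G.IsTree)
    {Ω : Set ℂ} {f : ℂ → ℂ} {α : ℝ} (hα : 0 < α) (hf : IsModulusLinearOn Ω f α)
    {A : Matrix V V ℂ} (hA : A ∈ graphMatrices G Ω) (hH : A.IsHermitian) :
    (A.PosDef ↔ (graphMap G f A).PosDef) ∧ (A.PosSemidef ↔ (graphMap G f A).PosSemidef) := by
  classical
  rw [mem_graphMatrices_iff] at hA
  have hu : ∀ z, ∃ u : Circle, z ∈ Ω → f z = α * (u * z) := by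
    intro z
    by_cases hz : z ∈ Ω ∧ z ≠ 0
    · have hαz : (α : ℂ) * z ≠ 0 := mul_ne_zero (by exact_mod_cast hα.ne') hz.2
      refine ⟨⟨f z / (α * z), ?_⟩, fun _ => ?_⟩
      · refine mem_sphere_zero_iff_norm.2 ?_
        rw [norm_div, norm_mul, (hf.2 z hz.1).1, Complex.norm_real, Real.norm_of_nonneg hα.le]
        exact div_self (mul_ne_zero hα.ne' (norm_ne_zero_iff.2 hz.2))
      · change f z = α * (f z / (α * z) * z)
        rw [← mul_assoc, mul_right_comm, mul_div_cancel₀ _ hαz]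
    · refine ⟨1, fun hz' => ?_⟩
      have h0 : z = 0 := not_not.1 fun h => hz ⟨hz', h⟩
      have := (hf.2 z hz').1
      rw [h0] at this ⊢
      simpa using this
  choose U hU using hu
  -- The phase at a zero entry is arbitrary, so it is set to 1 to keep `c j i = (c i j)⁻¹`. At
  -- nonzero entries this relation comes from `f (conj z) = conj (f z)`.
  obtain ⟨θ, hθ⟩ := exists_potential_of_isTree hG
    (fun i j => if A i j = 0 then (1 : Circle) else U (A i j)) (fun i j hij => by
      have hji : A j i = star (A i j) := (hH.apply j i).symm
      by_cases h0 : A i j = 0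
      · simp [hji, h0]
      · have hmem := (hA i j).2 (Or.inr hij)
        have e1 := hU _ hmem
        have e2 := hU _ ((hA j i).2 (Or.inr hij.symm))
        rw [hji, (hf.2 _ hmem).2, e1] at e2
        have hs0 : star (A i j) ≠ 0 := star_ne_zero.2 h0
        rw [if_neg h0, if_neg (by rwa [hji]), hji]
        ext
        rw [Circle.coe_inv_eq_conj]
        have hα' : (α : ℂ) ≠ 0 := by exact_mod_cast hα.ne'
        simp only [RCLike.star_def, map_mul, Complex.conj_ofReal] at e2 hs0 ⊢
        exact (mul_right_cancel₀ hs0 (mul_left_cancel₀ hα' e2)).symm)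
  set D : Matrix V V ℂ := diagonal fun v => (θ v : ℂ) with hD
  have hDu : IsUnit D := by
    rw [isUnit_diagonal, Pi.isUnit_iff]
    exact fun v => (Circle.coe_ne_zero _).isUnit
  have hfA : graphMap G f A = (α : ℂ) • (D * A * star D) := by
    ext i j
    have hDA : (D * A * star D) i j = θ i * A i j * star (θ j : ℂ) := by
      rw [star_eq_conjTranspose, hD, diagonal_conjTranspose, mul_diagonal, diagonal_mul]
      rfl
    rw [Matrix.smul_apply, hDA, smul_eq_mul]
    by_cases h : i = j ∨ G.Adj i j
    · rw [graphMap_apply_of h]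
      have hmem := (hA i j).2 h
      rcases h with rfl | h
      · have hre : A i i = ((A i i).re : ℂ) := (Complex.conj_eq_iff_re.1 (hH.apply i i)).symm
        rw [hre] at hmem ⊢
        rw [hf.1 _ hmem, RCLike.star_def, mul_right_comm, Complex.mul_conj, Circle.normSq_coe]
        simp
      · have e := hθ i j h
        by_cases h0 : A i j = 0
        · have := hU _ hmem
          rw [this, h0]
          simp
        · simp only [if_neg h0] at e
          rw [hU _ hmem, e, Circle.coe_mul, Circle.coe_inv_eq_conj, RCLike.star_def]
          ring
    · rw [graphMap_apply_of_not h, (hA i j).1 h]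
      simp
  rw [hfA, posDef_ofReal_smul_iff hα, posSemidef_ofReal_smul_iff hα,
    hDu.posDef_star_right_conjugate_iff, hDu.posSemidef_star_right_conjugate_iff]
  exact ⟨Iff.rfl, Iff.rfl⟩

/-- In the conjugate case the image is `α Aᵀ`, because `A` is Hermitian, and transposition preserves
positivity. -/
theorem posDef_graphMap_iff_of_isPositiveMultipleOn {V : Type*} {G : SimpleGraph V}
    {Ω : Set ℂ} {f : ℂ → ℂ} (hf : IsPositiveMultipleOn Ω f)
    {A : Matrix V V ℂ} (hA : A ∈ graphMatrices G Ω) (hH : A.IsHermitian) :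
    (A.PosDef ↔ (graphMap G f A).PosDef) ∧ (A.PosSemidef ↔ (graphMap G f A).PosSemidef) := by
  rw [mem_graphMatrices_iff] at hA
  obtain ⟨α, hα, hf | hf⟩ := hf
  · have : graphMap G f A = (α : ℂ) • A := by
      ext i j
      by_cases h : i = j ∨ G.Adj i j
      · rw [graphMap_apply_of h, hf _ ((hA i j).2 h)]; rfl
      · rw [graphMap_apply_of_not h, Matrix.smul_apply, (hA i j).1 h, smul_zero]
    rw [this, posDef_ofReal_smul_iff hα, posSemidef_ofReal_smul_iff hα]
    exact ⟨Iff.rfl, Iff.rfl⟩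
  · have : graphMap G f A = (α : ℂ) • Aᵀ := by
      ext i j
      by_cases h : i = j ∨ G.Adj i j
      · rw [graphMap_apply_of h, hf _ ((hA i j).2 h), Matrix.smul_apply, transpose_apply, ← hH.apply j i]
        rfl
      · rw [graphMap_apply_of_not h, Matrix.smul_apply, transpose_apply, ← hH.apply j i, (hA i j).1 h,
          star_zero, smul_zero]
    rw [this, posDef_ofReal_smul_iff hα, posSemidef_ofReal_smul_iff hα, PosDef.transpose_iff,
      posSemidef_transpose_iff]
    exact ⟨Iff.rfl, Iff.rfl⟩

/-! ### Rigidity on graphs with a cycle -/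

/-- A graph that is not acyclic has a vertex with two distinct neighbours joined by a walk avoiding
that vertex. -/
theorem exists_adj_adj_walk_of_not_isAcyclic {V : Type*} {G : SimpleGraph V} (hG : ¬ G.IsAcyclic) :
    ∃ v i j : V, G.Adj v i ∧ G.Adj v j ∧ i ≠ j ∧ ∃ q : G.Walk j i, v ∉ q.support := by
  simp only [SimpleGraph.IsAcyclic, not_forall, not_not] at hG
  obtain ⟨v, c, hc⟩ := hG
  cases c with
  | nil => exact absurd hc (by simp)
  | cons h p =>
    rename_i i
    rw [SimpleGraph.Walk.cons_isCycle_iff] at hc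
    obtain ⟨hp, he⟩ := hc
    have hr : p.reverse.IsPath := hp.reverse
    have he' : s(v, i) ∉ p.reverse.edges := by simpa using he
    generalize p.reverse = r at hr he'
    cases r with
    | nil => exact absurd rfl h.ne
    | cons h' q =>
      rename_i j
      rw [SimpleGraph.Walk.cons_isPath_iff] at hr
      refine ⟨v, i, j, h, h', ?_, q, hr.2⟩
      rintro rfl
      simp at he'

/-- Minimum principle for a strictly diagonally dominant graph operator. -/
theorem pos_of_graph_operator_eq_single {W : Type*} [Fintype W] [DecidableEq W]
    {H : SimpleGraph W} [DecidableRel H.Adj] {T : ℝ} (hT : (Fintype.card W : ℝ) < T) {x : W → ℝ}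
    {j : W} (hx : ∀ k, T * x k - ∑ l, (if H.Adj k l then x l else 0) = if k = j then 1 else 0)
    {i : W} (hij : H.Reachable i j) : 0 < x i := by
  have hT0 : 0 ≤ T := (Nat.cast_nonneg _).trans hT.le
  have hnn : ∀ k, 0 ≤ x k := by
    by_contra! hneg
    obtain ⟨k₀, hk₀⟩ := hneg
    obtain ⟨k, -, hk⟩ := Finset.exists_min_image Finset.univ x ⟨k₀, Finset.mem_univ _⟩
    have hkneg : x k < 0 := (hk k₀ (Finset.mem_univ _)).trans_lt hk₀
    have hsum : Fintype.card W * x k ≤ ∑ l, (if H.Adj k l then x l else 0) := by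
      rw [← nsmul_eq_mul]
      refine Finset.card_nsmul_le_sum _ _ _ fun l _ => ?_
      split_ifs
      · exact hk l (Finset.mem_univ _)
      · exact hkneg.le
    have h1 := hx k
    have h2 : (0 : ℝ) ≤ if k = j then 1 else 0 := by split_ifs <;> norm_num
    nlinarith
  -- At a zero of `x ≥ 0` the equation reads minus a nonnegative sum equals 0 or 1. So zeros spread
  -- to neighbours and, along a walk, would reach `j`, where the value 1 is impossible.
  have hzero : ∀ k, x k = 0 → k ≠ j ∧ ∀ l, H.Adj k l → x l = 0 := by
    intro k hk
    have h1 := hx k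
    have hterm : ∀ l ∈ Finset.univ, 0 ≤ if H.Adj k l then x l else 0 := fun l _ => by
      split_ifs
      · exact hnn l
      · exact le_rfl
    have hs := Finset.sum_nonneg hterm
    rw [hk, mul_zero, zero_sub] at h1
    have hkj : k ≠ j := by
      rintro rfl
      rw [if_pos rfl] at h1
      linarith
    rw [if_neg hkj, neg_eq_zero, Finset.sum_eq_zero_iff_of_nonneg hterm] at h1
    exact ⟨hkj, fun l hl => by simpa [hl] using h1 l (Finset.mem_univ _)⟩
  refine (hnn i).lt_of_ne fun h0 => ?_
  obtain ⟨p⟩ := hij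
  have : ∀ a b : W, H.Walk a b → x a = 0 → x b = 0 := by
    intro a b p
    induction p with
    | nil => exact id
    | cons h q ih => exact fun ha => ih ((hzero _ ha).2 _ h)
  exact (hzero j (this i j p h0.symm)).1 rfl

/-- The bordered matrix with corner `t`, first row `b` and lower right block `M`. -/
def bordered {W : Type*} (t : ℂ) (b : W → ℂ) (M : Matrix W W ℂ) :
    Matrix (Unit ⊕ W) (Unit ⊕ W) ℂ :=
  fromBlocks (of fun _ _ => t) (replicateRow Unit b) (replicateRow Unit b)ᴴ M

section bordered

variable {W : Type*} [Fintype W] [DecidableEq W] {M : Matrix W W ℂ}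

theorem bordered_schur (hM : M.PosDef) (b : W → ℂ) (t : ℝ) :
    (of fun _ _ => (t : ℂ)) - replicateRow Unit b * M⁻¹ * (replicateRow Unit b)ᴴ =
      diagonal fun _ => ((t - (b ⬝ᵥ (M⁻¹ *ᵥ star b)).re : ℝ) : ℂ) := by
  have him : (b ⬝ᵥ (M⁻¹ *ᵥ star b)).im = 0 := by
    have := hM.inv.isHermitian.im_star_dotProduct_mulVec_self (star b)
    rwa [star_star] at this
  ext ⟨⟩ ⟨⟩
  rw [diagonal_apply_eq, Matrix.sub_apply, Complex.ofReal_sub, Matrix.mul_assoc]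
  congr 1
  refine Eq.trans ?_ (Complex.ext rfl (by simpa using him) :
    b ⬝ᵥ (M⁻¹ *ᵥ star b) = (((b ⬝ᵥ (M⁻¹ *ᵥ star b)).re : ℝ) : ℂ))
  rfl

theorem bordered_posSemidef_iff (hM : M.PosDef) (b : W → ℂ) (t : ℝ) :
    (bordered t b M).PosSemidef ↔ (b ⬝ᵥ (M⁻¹ *ᵥ star b)).re ≤ t := by
  have := hM.isUnit.invertible
  rw [bordered, PosDef.fromBlocks₂₂ _ _ hM, bordered_schur hM, posSemidef_diagonal_iff]
  simp

theorem bordered_posDef (hM : M.PosDef) {b : W → ℂ} {t : ℝ}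
    (h : (b ⬝ᵥ (M⁻¹ *ᵥ star b)).re < t) :
    (bordered t b M).PosDef := by
  have := hM.isUnit.invertible
  rw [((bordered_posSemidef_iff hM b t).2 h.le).posDef_iff_det_ne_zero, bordered, det_fromBlocks₂₂,
    invOf_eq_nonsing_inv, bordered_schur hM, det_diagonal]
  refine mul_ne_zero hM.det_pos.ne' (Finset.prod_ne_zero_iff.2 fun _ _ => ?_)
  exact_mod_cast (sub_pos.2 h).ne'

end bordered

theorem dotProduct_single_add_single {W : Type*} [Fintype W] [DecidableEq W] {N : Matrix W W ℂ}
    (hN : N.IsHermitian) (i j : W) (z w : ℂ) :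
    ((Pi.single i z + Pi.single j w) ⬝ᵥ (N *ᵥ star (Pi.single i z + Pi.single j w))).re =
      ‖z‖ ^ 2 * (N i i).re + ‖w‖ ^ 2 * (N j j).re + 2 * (z * star w * N i j).re := by
  have hji : N j i = star (N i j) := (hN.apply j i).symm
  simp only [star_add, mulVec_add, dotProduct_add, add_dotProduct,
    single_dotProduct, mulVec_single, Pi.star_single]
  have hi := Complex.conj_eq_iff_im.1 (hN.apply i i)
  have hj := Complex.conj_eq_iff_im.1 (hN.apply j j)
  rw [← Complex.normSq_eq_norm_sq, ← Complex.normSq_eq_norm_sq, Complex.normSq_apply,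
    Complex.normSq_apply]
  simp [hji, hi, hj]
  ring

/-- Since `M` is real, `f` sends the bordered matrix to `α` times one with the same corner and
block, altering only the border. The Schur thresholds for `t` must then agree. -/
theorem IsWeakSignPreserver.bordered_eq {W : Type*} [Fintype W] [DecidableEq W]
    {H : SimpleGraph (Unit ⊕ W)} {f : ℂ → ℂ} {α : ℝ} (hf : IsWeakSignPreserver H Set.univ f)
    (hα : 0 < α) (hmod : IsModulusLinearOn Set.univ f α) {M : Matrix W W ℂ} (hM : M.PosDef)
    (hreal : ∀ k l, ∃ r : ℝ, M k l = r)
    (hpat : ∀ k l, ¬ (k = l ∨ H.Adj (Sum.inr k) (Sum.inr l)) → M k l = 0)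
    {b : W → ℂ} (hb : ∀ k, ¬ H.Adj (Sum.inl ()) (Sum.inr k) → b k = 0) :
    ((fun k => f (b k) / α) ⬝ᵥ (M⁻¹ *ᵥ star fun k => f (b k) / α)).re =
      (b ⬝ᵥ (M⁻¹ *ᵥ star b)).re := by
  have hα' : (α : ℂ) ≠ 0 := by exact_mod_cast hα.ne'
  have hmem : ∀ t : ℝ, bordered t b M ∈ graphMatrices H Set.univ := by
    intro t
    rw [mem_graphMatrices_iff]
    refine fun x y => ⟨fun h => ?_, fun _ => Set.mem_univ _⟩
    rcases x with ⟨⟩ | k <;> rcases y with ⟨⟩ | l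
    · exact absurd (Or.inl rfl) h
    · exact hb l fun h' => h (Or.inr h')
    · change star (b k) = 0
      rw [hb k fun h' => h (Or.inr h'.symm), star_zero]
    · exact hpat k l fun h' => h (h'.imp (congrArg _) id)
  have hf0 : f 0 = 0 := by simpa using (hmod.2 0 (Set.mem_univ _)).1
  have hfreal : ∀ r : ℝ, f r = α * r := fun r => by
    rw [hmod.1 r (Set.mem_univ _), Complex.ofReal_mul]
  have hmap : ∀ t : ℝ, graphMap H f (bordered t b M) =
      (α : ℂ) • bordered t (fun k => f (b k) / α) M := by
    intro t
    have hfmap : graphMap H f (bordered t b M) = (bordered t b M).map f := by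
      ext x y
      by_cases h : x = y ∨ H.Adj x y
      · rw [graphMap_apply_of h, map_apply]
      · rw [graphMap_apply_of_not h, map_apply, (mem_graphMatrices_iff.1 (hmem t) x y).1 h, hf0]
    rw [hfmap]
    ext x y
    rw [map_apply, Matrix.smul_apply, smul_eq_mul]
    rcases x with ⟨⟩ | k <;> rcases y with ⟨⟩ | l
    · exact hfreal t
    · exact (mul_div_cancel₀ (f (b l)) hα').symm
    · change f (star (b k)) = α * star (f (b k) / α)
      rw [(hmod.2 _ (Set.mem_univ _)).2, RCLike.star_def, map_div₀, Complex.conj_ofReal,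
        mul_div_cancel₀ _ hα']
    · obtain ⟨r, hr⟩ := hreal k l
      change f (M k l) = α * M k l
      rw [hr, hfreal]
  have hherm : ∀ t : ℝ, (bordered t b M).IsHermitian := fun t =>
    IsHermitian.fromBlocks (IsHermitian.ext fun _ _ => Complex.conj_ofReal t) rfl hM.isHermitian
  refine le_antisymm (le_of_forall_gt_imp_ge_of_dense fun t ht => ?_)
    (le_of_forall_gt_imp_ge_of_dense fun t ht => ?_)
  · have := (hf _ (hmem t) (hherm t)).1 (bordered_posDef hM ht)
    rwa [hmap, posSemidef_ofReal_smul_iff hα, bordered_posSemidef_iff hM] at this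
  · refine (bordered_posSemidef_iff hM b t).1 ((hf _ (hmem t) (hherm t)).2 ?_)
    rw [hmap, posDef_ofReal_smul_iff hα]
    exact bordered_posDef hM ht

theorem reachable_comap_of_walk {V : Type*} {G : SimpleGraph V} {v a b : V} (p : G.Walk a b)
    (hv : v ∉ p.support) (ha : a ≠ v) (hb : b ≠ v) :
    (G.comap (Subtype.val : {k // k ≠ v} → V)).Reachable ⟨a, ha⟩ ⟨b, hb⟩ := by
  induction p with
  | nil => exact SimpleGraph.Reachable.refl _
  | cons h q ih =>
    rename_i x y z
    rw [SimpleGraph.Walk.support_cons, List.mem_cons, not_or] at hv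
    have hy : y ≠ v := fun h => hv.2 (h ▸ q.start_mem_support)
    refine SimpleGraph.Reachable.trans ?_ (ih hv.2 hy hb)
    exact SimpleGraph.Adj.reachable (show G.Adj x y from h)

/-- A real positive definite matrix with the pattern of a graph, whose inverse has entries with
positive real part inside each connected component. -/
theorem exists_posDef_inv_pos {W : Type*} [Fintype W] [DecidableEq W] (H : SimpleGraph W) :
    ∃ M : Matrix W W ℂ, M.PosDef ∧ (∀ k l, ∃ r : ℝ, M k l = r) ∧
      (∀ k l, ¬ (k = l ∨ H.Adj k l) → M k l = 0) ∧
      ∀ i j, H.Reachable i j → 0 < (M⁻¹ i j).re := by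
  classical
  have he : Function.Injective (Empty.elim : Empty → W) := fun i => i.elim
  have hr : ∀ x : W, x ∉ Set.range (Empty.elim : Empty → W) := fun x ⟨y, _⟩ => y.elim
  obtain ⟨T₀, hT₀⟩ := exists_pad_posDef (G := H) (C := 0) (c := ((-1 : ℝ) : ℂ)) he
    (posDef_of_re_pos isHermitian_zero fun x hx => absurd (Subsingleton.elim _ _) hx)
    (fun i => i.elim) (Complex.conj_ofReal _)
  -- `T₀` secures definiteness, and `Fintype.card W + 1` the diagonal dominance needed by the
  -- minimum principle.
  set T : ℝ := max T₀ (Fintype.card W + 1)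
  have hT : (Fintype.card W : ℝ) < T := (lt_add_one _).trans_le (le_max_right _ _)
  set M := pad H (Empty.elim : Empty → W) 0 ((-1 : ℝ) : ℂ) (T : ℂ)
  have hM : M.PosDef := hT₀ T (le_max_left _ _)
  have hMdiag : ∀ k, M k k = T := fun k => pad_apply_self_of_notMem (hr k)
  have hMadj : ∀ k l, H.Adj k l → M k l = ((-1 : ℝ) : ℂ) := fun k l h =>
    pad_apply_adj h fun h' => hr k h'.1
  have hMnot : ∀ k l, ¬ (k = l ∨ H.Adj k l) → M k l = 0 := fun k l h => pad_apply_of_not h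
  refine ⟨M, hM, fun k l => ?_, hMnot, fun i j hij => ?_⟩
  · by_cases h : k = l ∨ H.Adj k l
    · rcases h with rfl | h
      · exact ⟨T, hMdiag k⟩
      · exact ⟨-1, hMadj k l h⟩
    · exact ⟨0, by rw [hMnot k l h, Complex.ofReal_zero]⟩
  · refine pos_of_graph_operator_eq_single (H := H) (x := fun k => (M⁻¹ k j).re) hT
      (fun k => ?_) hij
    have hdet : IsUnit M.det := (isUnit_iff_isUnit_det _).1 hM.isUnit
    have h1 : ∑ l, M k l * M⁻¹ l j = if k = j then 1 else 0 := by
      rw [← mul_apply, mul_nonsing_inv _ hdet, one_apply]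
    have h2 : ∀ l, (M k l * M⁻¹ l j).re = (if k = l then T * (M⁻¹ k j).re else 0) -
        (if H.Adj k l then (M⁻¹ l j).re else 0) := by
      intro l
      by_cases h : k = l ∨ H.Adj k l
      · rcases h with rfl | h
        · rw [hMdiag, Complex.re_ofReal_mul, if_pos rfl, if_neg (H.irrefl), sub_zero]
        · rw [hMadj k l h, Complex.re_ofReal_mul, if_neg h.ne, if_pos h]
          ring
      · rw [hMnot k l h, if_neg fun h' => h (Or.inl h'), if_neg fun h' => h (Or.inr h')]
        simp
    have h3 := congrArg Complex.re h1
    rw [Complex.re_sum, Finset.sum_congr rfl fun l _ => h2 l, Finset.sum_sub_distrib,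
      Finset.sum_ite_eq, if_pos (Finset.mem_univ _)] at h3
    rw [h3]
    split_ifs <;> simp

/-- With border entries `z`, `w` at the two neighbours of `v`, the diagonal terms of the Schur form
depend only on moduli, so the cross term is preserved. -/
theorem IsWeakSignPreserver.re_mul_star_eq {V : Type*} [Fintype V] {G : SimpleGraph V}
    {f : ℂ → ℂ} {α : ℝ} (hf : IsWeakSignPreserver G Set.univ f) (hα : 0 < α)
    (hmod : IsModulusLinearOn Set.univ f α) (hG : ¬ G.IsAcyclic) (z w : ℂ) :
    ((f z / α) * star (f w / α)).re = (z * star w).re := by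
  classical
  obtain ⟨v, i, j, hvi, hvj, hij, q, hq⟩ := exists_adj_adj_walk_of_not_isAcyclic hG
  have hfreal : ∀ r : ℝ, f r = (α * r : ℝ) := fun r => hmod.1 r (Set.mem_univ _)
  let W := {k // k ≠ v}
  let e : Unit ⊕ W → V := Sum.elim (fun _ => v) Subtype.val
  have he : Function.Injective e := by
    rintro (⟨⟩ | ⟨k, hk⟩) (⟨⟩ | ⟨l, hl⟩) h
    · rfl
    · exact absurd h.symm hl
    · exact absurd h hk
    · exact congrArg _ (Subtype.ext h)
  have hweak : IsWeakSignPreserver (G.comap e) Set.univ f := by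
    refine hf.comap (fun _ _ => Set.mem_univ _) ?_ (fun K => ?_) he
    · have := hfreal 1
      rw [Complex.ofReal_one] at this
      rw [this]
      exact Complex.conj_ofReal _
    · refine ⟨max K 1 / α, max K 1, by positivity, le_max_left _ _, ?_⟩
      rw [hfreal, mul_div_cancel₀ _ hα.ne']
  obtain ⟨M, hM, hreal, hpat, hpos⟩ :=
    exists_posDef_inv_pos (G.comap (Subtype.val : W → V))
  let i' : W := ⟨i, hvi.ne'⟩
  let j' : W := ⟨j, hvj.ne'⟩
  have hij' : i' ≠ j' := fun h => hij (congrArg Subtype.val h)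
  have hρ : 0 < (M⁻¹ i' j').re :=
    hpos i' j' (reachable_comap_of_walk q hq hvj.ne' hvi.ne').symm
  have hf0 : f 0 = 0 := by simpa using hmod.2 0 (Set.mem_univ _) |>.1
  have hnorm : ∀ z, ‖f z / α‖ = ‖z‖ := fun z => by
    rw [norm_div, (hmod.2 z (Set.mem_univ _)).1, Complex.norm_real, Real.norm_of_nonneg hα.le,
      mul_div_cancel_left₀ _ hα.ne']
  have key : ∀ z w : ℂ, ((f z / α) * star (f w / α) * M⁻¹ i' j').re =
      (z * star w * M⁻¹ i' j').re := by
    intro z w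
    have hb : (fun k => f ((Pi.single i' z + Pi.single j' w : W → ℂ) k) / α) =
        Pi.single i' (f z / α) + Pi.single j' (f w / α) := by
      ext k
      by_cases hki : k = i'
      · subst hki
        simp [hij']
      · by_cases hkj : k = j'
        · subst hkj
          simp [hki]
        · simp [hki, hkj, hf0]
    have := hweak.bordered_eq hα hmod hM hreal hpat (b := Pi.single i' z + Pi.single j' w)
      (fun k hk => by
        have hki : k ≠ i' := by rintro rfl; exact hk hvi
        have hkj : k ≠ j' := by rintro rfl; exact hk hvj
        simp [hki, hkj])
    rw [hb, dotProduct_single_add_single hM.inv.isHermitian,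
      dotProduct_single_add_single hM.inv.isHermitian, hnorm, hnorm] at this
    linarith
  have h1 := key z w
  -- Adding the conjugated identity cancels the imaginary part of `M⁻¹ i' j'`, so only its positive
  -- real part matters.
  have h2 := key (star z) (star w)
  rw [(hmod.2 z (Set.mem_univ _)).2, (hmod.2 w (Set.mem_univ _)).2] at h2
  generalize f z = z' at *
  generalize f w = w' at *
  have e1 : star z' / (α : ℂ) = star (z' / α) := by simp
  have e2 : star w' / (α : ℂ) = star (w' / α) := by simp
  rw [e1, e2] at h2
  generalize z' / (α : ℂ) = p at *
  generalize w' / (α : ℂ) = r at *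
  simp only [Complex.mul_re, Complex.mul_im, RCLike.star_def, Complex.conj_re,
    Complex.conj_im] at h1 h2 ⊢
  refine mul_right_cancel₀ hρ.ne' ?_
  linarith

/-- Pairing `φ = f / α` with 1 fixes real parts, and the modulus fixes imaginary parts up to sign.
Pairing with one non-real `z₀` whose sign flips makes all signs flip. -/
theorem IsWeakSignPreserver.isPositiveMultipleOn_univ {V : Type*} [Fintype V] {G : SimpleGraph V}
    {f : ℂ → ℂ} {α : ℝ} (hf : IsWeakSignPreserver G Set.univ f) (hα : 0 < α)
    (hmod : IsModulusLinearOn Set.univ f α) (hG : ¬ G.IsAcyclic) :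
    IsPositiveMultipleOn Set.univ f := by
  have hα' : (α : ℂ) ≠ 0 := by exact_mod_cast hα.ne'
  have key := hf.re_mul_star_eq hα hmod hG
  have hnorm : ∀ z, ‖f z / α‖ = ‖z‖ := fun z => by
    rw [norm_div, (hmod.2 z (Set.mem_univ _)).1, Complex.norm_real, Real.norm_of_nonneg hα.le,
      mul_div_cancel_left₀ _ hα.ne']
  have hone : f 1 / α = 1 := by
    have := hmod.1 1 (Set.mem_univ _)
    rw [mul_one, Complex.ofReal_one] at this
    rw [this, div_self hα']
  obtain ⟨φ, hφ⟩ : ∃ φ : ℂ → ℂ, ∀ z, φ z = f z / α := ⟨_, fun _ => rfl⟩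
  have hfφ : ∀ z, f z = α * φ z := fun z => by rw [hφ, mul_div_cancel₀ _ hα']
  simp only [← hφ] at key hnorm hone
  have hre : ∀ z, (φ z).re = z.re := fun z => by
    have := key z 1
    rw [hone] at this
    simpa using this
  have him : ∀ z, (φ z).im = z.im ∨ (φ z).im = -z.im := fun z => by
    have := congrArg (· ^ 2) (hnorm z)
    simp only [← Complex.normSq_eq_norm_sq, Complex.normSq_apply, hre] at this
    exact sq_eq_sq_iff_eq_or_eq_neg.1 (by linarith)
  refine ⟨α, hα, ?_⟩
  by_cases hall : ∀ z, φ z = z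
  · exact Or.inl fun z _ => by rw [hfφ, hall]
  · right
    push Not at hall
    obtain ⟨z₀, hz₀⟩ := hall
    have him₀ : (φ z₀).im = -z₀.im :=
      (him z₀).resolve_left fun h => hz₀ (Complex.ext (hre z₀) h)
    have hne : z₀.im ≠ 0 := fun h => hz₀ (Complex.ext (hre z₀) (by rw [him₀, h, neg_zero]))
    intro w _
    rw [hfφ]
    congr 1
    refine Complex.ext (hre w) ?_
    have := key z₀ w
    simp only [Complex.mul_re, RCLike.star_def, Complex.conj_re, Complex.conj_im, hre, him₀] at this
    rw [Complex.conj_im]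
    refine mul_left_cancel₀ hne ?_
    linarith

/-! ### The three domains and the final equivalences -/

theorem IsWeakSignPreserver.isModulusLinearOn_of_connected {V : Type*} [Fintype V]
    (hn : 3 ≤ Fintype.card V) {G : SimpleGraph V} (hG : G.Connected) {Ω : Set ℂ}
    (hΩ : Ω = realLine ∨ Ω = Set.univ ∨ Ω = positiveHalfLine) {f : ℂ → ℂ}
    (hf : IsWeakSignPreserver G Ω f)
    (hnc : ∃ x y : ℝ, 0 < x ∧ 0 < y ∧ f x ≠ f y) :
    ∃ α : ℝ, 0 < α ∧ IsModulusLinearOn Ω f α := by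
  obtain ⟨u, v, w, huv, hvw, huw⟩ := exists_adj_adj_of_connected hG hn
  refine hf.isModulusLinearOn ?_ ?_ ?_ hnc huv hvw huw <;> rcases hΩ with rfl | rfl | rfl
  · exact fun x _ => ⟨x, rfl⟩
  · exact fun x _ => Set.mem_univ _
  · exact fun x hx => ⟨x, hx, rfl⟩
  · rintro _ ⟨x, rfl⟩
    exact ⟨x, (Complex.conj_ofReal x).symm⟩
  · exact fun _ _ => Set.mem_univ _
  · rintro _ ⟨x, hx, rfl⟩
    exact ⟨x, hx, (Complex.conj_ofReal x).symm⟩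
  · exact fun _ _ _ => ⟨0, Complex.ofReal_zero⟩
  · exact fun _ _ _ => Set.mem_univ _
  · rintro x hx ⟨y, hy, hxy⟩
    rw [← Complex.ofReal_injective hxy] at hx
    exact absurd hx (not_le.2 hy)

theorem IsWeakSignPreserver.isPositiveMultipleOn {V : Type*} [Fintype V] {G : SimpleGraph V}
    {Ω : Set ℂ} (hΩ : Ω = realLine ∨ Ω = Set.univ ∨ Ω = positiveHalfLine) {f : ℂ → ℂ}
    (hf : IsWeakSignPreserver G Ω f) {α : ℝ} (hα : 0 < α) (hmod : IsModulusLinearOn Ω f α)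
    (hG : ¬ G.IsAcyclic) : IsPositiveMultipleOn Ω f := by
  rcases hΩ with rfl | rfl | rfl
  · refine ⟨α, hα, Or.inl ?_⟩
    rintro _ ⟨x, rfl⟩
    rw [hmod.1 x ⟨x, rfl⟩, Complex.ofReal_mul]
  · exact hf.isPositiveMultipleOn_univ hα hmod hG
  · refine ⟨α, hα, Or.inl ?_⟩
    rintro _ ⟨x, hx, rfl⟩
    rw [hmod.1 x ⟨x, hx, rfl⟩, Complex.ofReal_mul]

theorem ofReal_mem_of_pos {Ω : Set ℂ}
    (hΩ : Ω = realLine ∨ Ω = Set.univ ∨ Ω = positiveHalfLine) (x : ℝ) (hx : 0 < x) :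
    (x : ℂ) ∈ Ω := by
  rcases hΩ with rfl | rfl | rfl
  · exact ⟨x, rfl⟩
  · exact Set.mem_univ _
  · exact ⟨x, hx, rfl⟩

end SignPreservers

theorem theoremD {V : Type*} [Fintype V] (hn : 3 ≤ Fintype.card V)
    (G : SimpleGraph V) (hG : G.Connected)
    (Ω : Set ℂ)
    (hΩ : Ω = SignPreservers.realLine ∨ Ω = Set.univ ∨ Ω = SignPreservers.positiveHalfLine)
    (f : ℂ → ℂ) :
    (G.IsTree →
      (SignPreservers.IsPosDefSignPreserver G Ω f ↔
        ∃ α : ℝ, 0 < α ∧ SignPreservers.IsPowerTypeOn Ω f α 1) ∧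
      (SignPreservers.IsPosSemidefSignPreserver G Ω f ↔
        ∃ α : ℝ, 0 < α ∧ SignPreservers.IsPowerTypeOn Ω f α 1)) ∧
    (¬ G.IsTree →
      (SignPreservers.IsPosDefSignPreserver G Ω f ↔
        SignPreservers.IsPositiveMultipleOn Ω f) ∧
      (SignPreservers.IsPosSemidefSignPreserver G Ω f ↔
        SignPreservers.IsPositiveMultipleOn Ω f)) := by
  obtain ⟨u, v, w, huv, -, -⟩ := SignPreservers.exists_adj_adj_of_connected hG hn
  have hpos := SignPreservers.ofReal_mem_of_pos hΩ
  have hD : SignPreservers.IsPosDefSignPreserver G Ω f →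
      ∃ α : ℝ, 0 < α ∧ SignPreservers.IsModulusLinearOn Ω f α := fun h =>
    h.weak.isModulusLinearOn_of_connected hn hG hΩ
      (SignPreservers.not_const_of_separates huv hpos (fun _ hA => hA)
        (fun _ hA => hA.posSemidef) h)
  have hS : SignPreservers.IsPosSemidefSignPreserver G Ω f →
      ∃ α : ℝ, 0 < α ∧ SignPreservers.IsModulusLinearOn Ω f α := fun h =>
    h.weak.isModulusLinearOn_of_connected hn hG hΩ
      (SignPreservers.not_const_of_separates huv hpos (fun _ hA => hA.posSemidef)
        (fun _ hA => hA) h)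
  refine ⟨fun hT => ?_, fun hT => ?_⟩
  · have heq : (∃ α : ℝ, 0 < α ∧ SignPreservers.IsPowerTypeOn Ω f α 1) ↔
        ∃ α : ℝ, 0 < α ∧ SignPreservers.IsModulusLinearOn Ω f α :=
      exists_congr fun α => and_congr_right fun hα => SignPreservers.isPowerTypeOn_one_iff hα
    rw [heq]
    exact ⟨⟨hD, fun ⟨α, hα, hf⟩ A hA hH =>
        (SignPreservers.posDef_graphMap_iff_of_isTree hT hα hf hA hH).1⟩,
      ⟨hS, fun ⟨α, hα, hf⟩ A hA hH =>
        (SignPreservers.posDef_graphMap_iff_of_isTree hT hα hf hA hH).2⟩⟩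
  · have hac : ¬ G.IsAcyclic := fun h => hT ⟨hG, h⟩
    refine ⟨⟨fun h => ?_, fun hf A hA hH =>
        (SignPreservers.posDef_graphMap_iff_of_isPositiveMultipleOn hf hA hH).1⟩,
      ⟨fun h => ?_, fun hf A hA hH =>
        (SignPreservers.posDef_graphMap_iff_of_isPositiveMultipleOn hf hA hH).2⟩⟩
    · obtain ⟨α, hα, hmod⟩ := hD h
      exact h.weak.isPositiveMultipleOn hΩ hα hmod hac
    · obtain ⟨α, hα, hmod⟩ := hS h
      exact h.weak.isPositiveMultipleOn hΩ hα hmod hac
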